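/- Let $X$ be a $\mathbb{Z}_2$-CW complex, i.e. a Hausdorff CW complex with a continuous involution $\iota$ such that $\iota$ permutes the characteristic maps of the cells (so that a cell carried to itself is fixed pointwise). Let $E$ be any model of $E\mathbb{Z}_2$: a contractible space with a continuous involution $\tau$ such that $E\to E/\tau$ is a principal $\mathbb{Z}_2$-bundle. Write $E\times_{\mathbb{Z}_2}X$ for the quotient of $E\times X$ by the diagonal involution $(e,x)\mapsto(\tau e,\iota x)$, and put $$H^n_{\mathbb{Z}_2}(X)=H^n(E\times_{\mathbb{Z}_2}X;\mathbb{Z}),\qquad H^n_{\pm}(X)=H^n(E\times_{\mathbb{Z}_2}X;\mathbb{Z}(1)),$$ where the first group is integral singular cohomology and the second is singular cohomology with coefficients in the local system $\mathbb{Z}(1)=(E\times X\times\mathbb{Z})/\big((e,x,m)\sim(\tau e,\iota x,-m)\big)$. Equivalently, $H^n_\pm(X)$ is the cohomology of the complex of integral singular cochains $c$ on $E\times X$ that satisfy $c((\tau\times\iota)\circ s)=-c(s)$ for every singular simplex $s$. Let $\mathbb{T}_{\mathrm{triv}}$ and $\mathbb{T}_{\mathrm{conj}}$ be the unit circle in $\mathbb{C}$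 with the trivial involution and with complex conjugation, respectively, and let $[X,\mathbb{T}_{\mathrm{triv}}]_{\mathbb{Z}_2}$ and $[X,\mathbb{T}_{\mathrm{conj}}]_{\mathbb{Z}_2}$ be the groups, under pointwise multiplication, of equivariant homotopy classes of continuous equivariant maps from $X$. Then there are isomorphisms of groups $$H^1_{\mathbb{Z}_2}(X)\cong[X,\mathbb{T}_{\mathrm{triv}}]_{\mathbb{Z}_2},\qquad H^1_{\pm}(X)\cong[X,\mathbb{T}_{\mathrm{conj}}]_{\mathbb{Z}_2}.$$ -/

import Mathlib

noncomputable section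

namespace EquivCoh

universe u v

/-! ### Singular cochains -/

/-- The inclusion of the `i`-th face of the standard `(n + 1)`-simplex. -/
def face {n : ℕ} (i : Fin (n + 2)) :
    C(stdSimplex ℝ (Fin (n + 1)), stdSimplex ℝ (Fin (n + 2))) :=
  ⟨stdSimplex.map i.succAbove, stdSimplex.continuous_map i.succAbove⟩

/-- Singular `n`-simplices of a space. -/
abbrev SingularSimplex (Y : Type u) [TopologicalSpace Y] (n : ℕ) : Type u :=
  C(stdSimplex ℝ (Fin (n + 1)), Y)

/-- Integral singular `n`-cochains: homomorphisms from the free abelian group on the singular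
`n`-simplices to `ℤ`, that is, functions on the singular `n`-simplices. -/
abbrev Cochain (Y : Type u) [TopologicalSpace Y] (n : ℕ) : Type u :=
  SingularSimplex Y n → ℤ

/-- The singular coboundary `(δ c)(s) = ∑ i, (-1)^i c(s ∘ face i)`. -/
def coboundary (Y : Type u) [TopologicalSpace Y] (n : ℕ) : Cochain Y n →+ Cochain Y (n + 1) where
  toFun c := fun s => ∑ i : Fin (n + 2), (-1 : ℤ) ^ (i : ℕ) * c (s.comp (face i))
  map_zero' := by
    funext s
    simp
  map_add' c c' := by
    funext s
    simp [mul_add, Finset.sum_add_distrib]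

section Subcomplex

variable {Y : Type u} [TopologicalSpace Y]

/-- The `n`-cocycles of a subcomplex `A` of the singular cochain complex. -/
def cocycles (A : ∀ n, AddSubgroup (Cochain Y n)) (n : ℕ) : AddSubgroup (Cochain Y n) :=
  A n ⊓ (coboundary Y n).ker

/-- The `n`-coboundaries of a subcomplex `A` of the singular cochain complex. -/
def coboundaries (A : ∀ n, AddSubgroup (Cochain Y n)) : ∀ n, AddSubgroup (Cochain Y n)
  | 0 => ⊥
  | n + 1 => (A n).map (coboundary Y n)

/-- The `n`-th cohomology group of a subcomplex `A` of the singular cochain complex. -/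
abbrev Cohomology (A : ∀ n, AddSubgroup (Cochain Y n)) (n : ℕ) : Type u :=
  cocycles A n ⧸ (coboundaries A n).addSubgroupOf (cocycles A n)

end Subcomplex

/-- Integral singular cohomology of a space. -/
abbrev SingularCohomology (Y : Type u) [TopologicalSpace Y] (n : ℕ) : Type u :=
  Cohomology (Y := Y) (fun _ => ⊤) n

/-- The cochains `c` on `Y` with `c (σ ∘ s) = - c s`, where `σ` is an involution of `Y`: the
homomorphisms of `ℤ[ℤ/2]`-modules from the singular chains of `Y` to `ℤ(1)`, where `ℤ(1)` is `ℤ`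
with the generator of `ℤ/2` acting as `-1`. -/
def antiInvariantCochains {Y : Type u} [TopologicalSpace Y] (σ : C(Y, Y)) (n : ℕ) :
    AddSubgroup (Cochain Y n) where
  carrier := {c | ∀ s : SingularSimplex Y n, c (σ.comp s) = - c s}
  zero_mem' := by
    intro s
    simp
  add_mem' := by
    intro c c' hc hc' s
    have h := hc s
    have h' := hc' s
    simp only [Pi.add_apply, h, h']
    ring
  neg_mem' := by
    intro c hc s
    have h := hc s
    simp only [Pi.neg_apply, h]

/-- The coboundary preserves anti-invariant cochains. -/
theorem coboundary_mem_antiInvariantCochains {Y : Type u} [TopologicalSpace Y] (σ : C(Y, Y))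
    (n : ℕ) {c : Cochain Y n} (hc : c ∈ antiInvariantCochains σ n) :
    coboundary Y n c ∈ antiInvariantCochains σ (n + 1) := by
  intro s
  have h : ∀ i : Fin (n + 2), c ((σ.comp s).comp (face i)) = - c (s.comp (face i)) :=
    fun i => hc (s.comp (face i))
  simp only [coboundary, AddMonoidHom.coe_mk, ZeroHom.coe_mk, h]
  simp

/-- Let `Y → Y / σ` be a double covering with covering involution `σ`, and let `ℤ(1)` be the local
system `(Y × ℤ) / ((y, m) ∼ (σ y, -m))` on `Y / σ`, in which a loop acts as `1` or `-1` according
to whether it lifts to a loop of `Y`. This is the cohomology of `Y / σ` with local coefficients in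
`ℤ(1)`, computed as usual from the equivariant cochains on the covering space `Y`. -/
abbrev TwistedCohomology {Y : Type u} [TopologicalSpace Y] (σ : C(Y, Y)) (n : ℕ) : Type u :=
  Cohomology (antiInvariantCochains σ) n

/-! ### The Borel construction -/

/-- The orbit relation of an involution. -/
def orbitSetoid {Y : Type u} (σ : Y → Y) (hσ : Function.Involutive σ) : Setoid Y where
  r p q := p = q ∨ σ p = q
  iseqv :=
    { refl := fun _ => Or.inl rfl
      symm := by
        rintro p q (rfl | rfl)
        · exact Or.inl rfl
        · exact Or.inr (hσ p)
      trans := by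
        rintro p q r (rfl | rfl) (rfl | rfl)
        · exact Or.inl rfl
        · exact Or.inr rfl
        · exact Or.inr rfl
        · exact Or.inl (hσ p).symm }

/-- A model `(E, τ)` of the universal free `ℤ/2`-space: a contractible space with a continuous
involution for which `E → E / τ` is a principal `ℤ/2`-bundle, that is, every point has an open
neighbourhood disjoint from its translate. -/
structure IsUniversalFree {E : Type v} [TopologicalSpace E] (τ : C(E, E)) : Prop where
  involutive : Function.Involutive τ
  contractible : ContractibleSpace E
  exists_disjoint : ∀ e : E, ∃ U : Set E, IsOpen U ∧ e ∈ U ∧ Disjoint U (τ '' U)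

section Borel

variable {E : Type v} [TopologicalSpace E] {X : Type u} [TopologicalSpace X]

/-- The diagonal involution on `E × X`. -/
abbrev diagonal (τ : C(E, E)) (ι : C(X, X)) : C(E × X, E × X) := τ.prodMap ι

theorem diagonal_involutive {τ : C(E, E)} {ι : C(X, X)} (hτ : Function.Involutive τ)
    (hι : Function.Involutive ι) : Function.Involutive (diagonal τ ι) := by
  rintro ⟨e, x⟩
  exact Prod.ext (hτ e) (hι x)

/-- The Borel construction `E ×_{ℤ/2} X`, with the quotient topology. -/
abbrev BorelConstruction (τ : C(E, E)) (ι : C(X, X)) (hτ : Function.Involutive τ)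
    (hι : Function.Involutive ι) : Type (max u v) :=
  Quotient (orbitSetoid (diagonal τ ι) (diagonal_involutive hτ hι))

/-- Borel equivariant cohomology `H^n_{ℤ/2}(X) = H^n(E ×_{ℤ/2} X; ℤ)`. -/
abbrev BorelCohomology (τ : C(E, E)) (ι : C(X, X)) (hτ : Function.Involutive τ)
    (hι : Function.Involutive ι) (n : ℕ) : Type (max u v) :=
  SingularCohomology (BorelConstruction τ ι hτ hι) n

/-- Twisted equivariant cohomology `H^n_±(X) = H^n_{ℤ/2}(X; ℤ(1))`: the cohomology of
`E ×_{ℤ/2} X` with coefficients in the local system `ℤ(1)` defined by the double covering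
`E × X → E ×_{ℤ/2} X`. -/
abbrev TwistedBorelCohomology (τ : C(E, E)) (ι : C(X, X)) (n : ℕ) : Type (max u v) :=
  TwistedCohomology (diagonal τ ι) n

end Borel

/-! ### `ℤ/2`-CW complexes -/

/-- A CW structure on `X` is a `ℤ/2`-CW structure for the involution `ι` when `ι` carries
characteristic maps to characteristic maps. If `j = i` below, the closed cell is fixed pointwise
and is a cell of type `(ℤ/2)/(ℤ/2) × D^n`; otherwise `i` and `j` make up a cell of type
`ℤ/2 × D^n`. -/
def IsZ2CW {X : Type u} [TopologicalSpace X] [Topology.CWComplex (Set.univ : Set X)] (ι : C(X, X)) : Prop :=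
  ∀ (n : ℕ) (i : Topology.RelCWComplex.cell (Set.univ : Set X) n),
    ∃ j : Topology.RelCWComplex.cell (Set.univ : Set X) n,
      ∀ x ∈ Metric.closedBall (0 : Fin n → ℝ) 1,
        ι (Topology.RelCWComplex.map n i x) = Topology.RelCWComplex.map n j x

/-! ### Equivariant homotopy classes of maps to the circle -/

/-- Complex conjugation on the unit circle. -/
def circleConj : Circle →* Circle where
  toFun z := ⟨starRingEnd ℂ z, mem_sphere_zero_iff_norm.2 ((RCLike.norm_conj (z : ℂ)).trans z.norm_coe)⟩
  map_one' := Circle.ext (map_one (starRingEnd ℂ))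
  map_mul' z w := Circle.ext (map_mul (starRingEnd ℂ) (z : ℂ) (w : ℂ))

section Maps

variable {X : Type u} [TopologicalSpace X]

/-- `f` is equivariant for the involution `ι` of `X` and the involution `θ` of the circle. -/
def IsEquivariant (ι : C(X, X)) (θ : Circle →* Circle) (f : C(X, Circle)) : Prop :=
  ∀ x, f (ι x) = θ (f x)

/-- The group of equivariant maps to the circle, under pointwise multiplication. -/
def equivariantMaps (ι : C(X, X)) (θ : Circle →* Circle) : Subgroup C(X, Circle) where
  carrier := {f | IsEquivariant ι θ f}
  one_mem' := by
    intro x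
    simp
  mul_mem' := by
    intro f g hf hg x
    have h := hf x
    have h' := hg x
    simp [h, h']
  inv_mem' := by
    intro f hf x
    have h := hf x
    simp [h]

/-- Equivariant homotopy (a homotopy all of whose stages are equivariant) is a congruence on the
group of equivariant maps. -/
def homotopyCon (ι : C(X, X)) (θ : Circle →* Circle) : Con (equivariantMaps ι θ) where
  r f g := ContinuousMap.HomotopicWith (f : C(X, Circle)) (g : C(X, Circle)) (IsEquivariant ι θ)
  iseqv :=
    { refl := fun f => ContinuousMap.HomotopicWith.refl f.1 f.2
      symm := fun h => h.symm
      trans := fun h h' => h.trans h' }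
  mul' := by
    rintro f f' g g' ⟨F⟩ ⟨G⟩
    refine ⟨⟨⟨⟨fun p => F p * G p, by fun_prop⟩, ?_, ?_⟩, ?_⟩⟩
    · intro x
      simp
    · intro x
      simp
    · intro t x
      have h := F.prop t x
      have h' := G.prop t x
      simp only [ContinuousMap.coe_mk] at h h' ⊢
      exact (congrArg₂ (· * ·) h h').trans (map_mul θ _ _).symm

/-- The group `[X, 𝕋]_{ℤ/2}` of equivariant homotopy classes of equivariant maps to the circle with
involution `θ`. -/
abbrev HomotopyClasses (ι : C(X, X)) (θ : Circle →* Circle) : Type u :=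
  (homotopyCon ι θ).Quotient

end Maps

end EquivCoh

end

/-! Fix a sign `ε = ±1`, acting on `ℝ` by multiplication and compatibly on the circle `ℝ/ℤ`. Both
isomorphisms are the same statement about cocycles `c` on `E × X` that change by `ε` under the
diagonal involution. The link between such a `c` and an equivariant map `f` is a usually
discontinuous function `φ : E × X → ℝ`, equivariant for `ε`, with `exp(2πiφ) = f`, whose jumps are
recorded by `c`: along every map from a real vector space, `φ` plus the integral of `c` from a base
point is continuous (`Represents`).

Every `f` has such a `c`: lift `f` pointwise and equivariantly, which is possible as the involution
on `E × X` is free, and let `c` be the change of a continuous lift along a simplex minus the change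
of `φ` (`exists_represents`). Every `c` has such an `f` (`exists_represented`): a primitive on a
slice `{e} × X` is built cell by cell (`exists_isPrimitive`), spread over `E × X` by a contraction
of `E`, and averaged over the involution. Since `c` is integral, `exp(2πiφ)` is continuous on cells,
and it does not depend on the point of `E`.

The correspondence is additive. If `f = 1`, then `φ` is an integral `0`-cochain and `c` is the
coboundary of `-φ`. If `c = δb`, then `φ + b` descends to an equivariant continuous real lift of
`f`. By homotopy lifting, two equivariant maps are equivariantly homotopic exactly when their
quotient has such a lift. Hence the classes agree on both sides.

For `ε = -1` these cochains are the twisted ones. For `ε = 1` they are the cochains of the Borel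
construction, because simplices lift along the double covering, uniquely up to the involution. -/

noncomputable section

namespace EquivCoh

universe u v

open Topology Metric Set

section

/-! ### Affine simplices -/

section Affine

variable {V : Type*} [AddCommGroup V] [Module ℝ V] [TopologicalSpace V] [IsTopologicalAddGroup V]
  [ContinuousSMul ℝ V]
variable {W : Type*} [AddCommGroup W] [Module ℝ W] [TopologicalSpace W] [IsTopologicalAddGroup W]
  [ContinuousSMul ℝ W]

/-- The affine singular simplex with given vertices. -/
def affineSimplex {n : ℕ} (v : Fin (n + 1) → V) : C(stdSimplex ℝ (Fin (n + 1)), V) where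
  toFun s := ∑ i, s i • v i
  continuous_toFun := by
    refine continuous_finsetSum _ fun i _ => Continuous.smul ?_ continuous_const
    exact (continuous_apply i).comp continuous_subtype_val

theorem affineSimplex_apply {n : ℕ} (v : Fin (n + 1) → V) (s : stdSimplex ℝ (Fin (n + 1))) :
    affineSimplex v s = ∑ i, s i • v i := rfl

theorem face_apply_self {n : ℕ} (i : Fin (n + 2)) (s : stdSimplex ℝ (Fin (n + 1))) :
    face i s i = 0 := by
  simp [face, FunOnFinite.linearMap_apply_apply, Fin.succAbove_ne]

theorem face_apply_succAbove {n : ℕ} (i : Fin (n + 2)) (s : stdSimplex ℝ (Fin (n + 1)))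
    (k : Fin (n + 1)) : face i s (i.succAbove k) = s k := by
  simp [face, FunOnFinite.linearMap_apply_apply, Finset.filter_eq']

theorem affineSimplex_comp_face {n : ℕ} (v : Fin (n + 2) → V) (i : Fin (n + 2)) :
    (affineSimplex v).comp (face i) = affineSimplex (v ∘ i.succAbove) := by
  ext s
  simp [affineSimplex_apply, Fin.sum_univ_succAbove _ i, face_apply_self, face_apply_succAbove]

/-- The affine singular `1`-simplex from `p` to `q`. -/
def seg (p q : V) : C(stdSimplex ℝ (Fin 2), V) := affineSimplex ![p, q]

theorem seg_apply (p q : V) (s : stdSimplex ℝ (Fin 2)) : seg p q s = s 0 • p + s 1 • q := by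
  simp [seg, affineSimplex_apply, Fin.sum_univ_two]

theorem seg_self_apply (p : V) (s : stdSimplex ℝ (Fin 2)) : seg p p s = p := by
  rw [seg_apply, ← add_smul, stdSimplex.add_eq_one, one_smul]

theorem seg_mem {K : Set V} (hK : Convex ℝ K) {p q : V} (hp : p ∈ K) (hq : q ∈ K)
    (s : stdSimplex ℝ (Fin 2)) : seg p q s ∈ K := by
  rw [seg_apply]
  exact hK hp hq (stdSimplex.zero_le s 0) (stdSimplex.zero_le s 1) (stdSimplex.add_eq_one s)

variable {Y : Type u} [TopologicalSpace Y]

/-- Two maps that agree on a segment have the same restriction to it. -/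
theorem comp_seg_congr {K : Set V} (hK : Convex ℝ K) {p q : V} (hp : p ∈ K) (hq : q ∈ K)
    {f g : C(V, Y)} (h : ∀ x ∈ K, f x = g x) : f.comp (seg p q) = g.comp (seg p q) := by
  ext s
  exact h _ (seg_mem hK hp hq s)

/-- A singular `1`-cochain is a cocycle if its coboundary vanishes. -/
def IsCocycle (c : Cochain Y 1) : Prop := coboundary Y 1 c = 0

/-- This is the vanishing of `δc` on the affine triangle with vertices `p`, `q`, `r`. -/
theorem IsCocycle.triangle {c : Cochain Y 1} (hc : IsCocycle c) (f : C(V, Y)) (p q r : V) :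
    c (f.comp (seg p q)) + c (f.comp (seg q r)) = c (f.comp (seg p r)) := by
  have h := congrFun hc (f.comp (affineSimplex ![p, q, r]))
  have h0 : (![p, q, r] : Fin 3 → V) ∘ (0 : Fin 3).succAbove = ![q, r] := by
    ext i; fin_cases i <;> rfl
  have h1 : (![p, q, r] : Fin 3 → V) ∘ (1 : Fin 3).succAbove = ![p, r] := by
    ext i; fin_cases i <;> rfl
  have h2 : (![p, q, r] : Fin 3 → V) ∘ (2 : Fin 3).succAbove = ![p, q] := by
    ext i; fin_cases i <;> rfl
  change ∑ i : Fin 3, (-1 : ℤ) ^ (i : ℕ) *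
    c ((f.comp (affineSimplex ![p, q, r])).comp (face i)) = 0 at h
  simp only [Fin.sum_univ_three, ContinuousMap.comp_assoc] at h
  rw [affineSimplex_comp_face, affineSimplex_comp_face, affineSimplex_comp_face, h0, h1, h2] at h
  simp only [seg]
  norm_num at h
  linarith

theorem IsCocycle.seg_self {c : Cochain Y 1} (hc : IsCocycle c) (f : C(V, Y)) (p : V) :
    c (f.comp (seg p p)) = 0 := by
  have := hc.triangle f p p p
  linarith

theorem IsCocycle.const {c : Cochain Y 1} (hc : IsCocycle c) (y : Y) :
    c (ContinuousMap.const _ y) = 0 := by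
  have := hc.seg_self (ContinuousMap.const ℝ y) 0
  rwa [ContinuousMap.const_comp] at this

theorem IsCocycle.of_forall_eq {c : Cochain Y 1} (hc : IsCocycle c) {s : SingularSimplex Y 1} {y : Y}
    (h : ∀ t, s t = y) : c s = 0 := by
  rw [← hc.const y]
  congr 1
  ext t
  exact h t

/-- Cut the square along its diagonal: both sides are the value of `c` on the segment from `(p, 0)`
to `(q, 1)`. Applied to homotopies, this compares `c` on the two ends through the tracks of the end
points. -/
theorem IsCocycle.square {c : Cochain Y 1} (hc : IsCocycle c) (f : C(V × ℝ, Y)) (p q : V) :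
    c ((f.comp ((ContinuousMap.id V).prodMk (.const V 0))).comp (seg p q)) +
        c ((f.comp ((ContinuousMap.const ℝ q).prodMk (.id ℝ))).comp (seg 0 1)) =
      c ((f.comp ((ContinuousMap.const ℝ p).prodMk (.id ℝ))).comp (seg 0 1)) +
        c ((f.comp ((ContinuousMap.id V).prodMk (.const V 1))).comp (seg p q)) := by
  have h1 : ∀ t : ℝ, (f.comp ((ContinuousMap.id V).prodMk (.const V t))).comp (seg p q) =
      f.comp (seg (p, t) (q, t)) := by
    intro t
    ext s
    have h : s 0 * t + s 1 * t = t := by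
      rw [← add_mul, stdSimplex.add_eq_one, one_mul]
    simp [seg_apply, h]
  have h2 : ∀ x : V, (f.comp ((ContinuousMap.const ℝ x).prodMk (.id ℝ))).comp (seg 0 1) =
      f.comp (seg (x, 0) (x, 1)) := by
    intro x
    ext s
    have h := seg_self_apply x s
    simp only [seg_apply] at h
    simp [seg_apply, h]
  rw [h1, h1, h2, h2, hc.triangle, hc.triangle]

/-- A cocycle on a convex space is the coboundary of its values on the segments from a base
point. -/
theorem IsCocycle.cone {c : Cochain Y 1} (hc : IsCocycle c) (f : C(V, Y)) (w : C(W, V)) (p : V)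
    (a b : W) :
    c ((f.comp w).comp (seg a b)) = c (f.comp (seg p (w b))) - c (f.comp (seg p (w a))) := by
  -- The straight-line homotopy from the constant map `p` to `w`; the bottom side of its square is
  -- constant and contributes nothing.
  let F : C(W × ℝ, Y) := f.comp ⟨fun z => p + z.2 • (w z.1 - p), by fun_prop⟩
  have h := hc.square F a b
  have h0 : c ((F.comp ((ContinuousMap.id W).prodMk (.const W 0))).comp (seg a b)) = 0 :=
    hc.of_forall_eq (y := f p) fun t => by simp [F]
  have h1 : F.comp ((ContinuousMap.id W).prodMk (.const W 1)) = f.comp w := by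
    ext x; simp [F]
  have h2 : ∀ x : W, (F.comp ((ContinuousMap.const ℝ x).prodMk (.id ℝ))).comp (seg 0 1) =
      f.comp (seg p (w x)) := by
    intro x
    ext s
    have h := stdSimplex.add_eq_one s
    have h' : s 0 = 1 - s 1 := by linarith
    change f (p + (seg (0 : ℝ) 1 s) • (w x - p)) = f (seg p (w x) s)
    simp only [seg_apply, h', smul_eq_mul, mul_one]
    congr 1
    module
  rw [h0, h1, h2, h2] at h
  linarith

end Affine

/-! ### Extension of singular simplices to real vector spaces -/

/-- A retraction of `ℝⁿ⁺¹` onto the standard simplex. -/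
def simplexRetraction (n : ℕ) : C(Fin (n + 1) → ℝ, stdSimplex ℝ (Fin (n + 1))) where
  -- Negative coordinates are cut off. If the remaining sum exceeds `1`, divide by it; otherwise
  -- share the deficit equally among the coordinates.
  toFun v := ⟨fun i => (max (v i) 0 + (1 - min (∑ j, max (v j) 0) 1) / (n + 1)) /
      max (∑ j, max (v j) 0) 1, by
    have hS : 0 ≤ ∑ j, max (v j) 0 := Finset.sum_nonneg fun j _ => le_max_right _ _
    constructor
    · intro i
      have := min_le_right (∑ j, max (v j) 0) 1
      have h2 := le_max_right (v i) 0
      refine div_nonneg (add_nonneg h2 (div_nonneg (by linarith) (by positivity))) ?_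
      exact le_max_of_le_right zero_le_one
    · rw [← Finset.sum_div, Finset.sum_add_distrib]
      generalize (∑ j, max (v j) 0) = S
      simp only [Finset.sum_const, Finset.card_univ, Fintype.card_fin, nsmul_eq_mul]
      push_cast
      rw [mul_div_cancel₀ _ (by positivity : (n : ℝ) + 1 ≠ 0)]
      rcases le_total S 1 with h | h
      · simp [max_eq_right h, min_eq_left h]
      · have : S ≠ 0 := by positivity
        simp [h, this]⟩
  continuous_toFun := by
    refine Continuous.subtype_mk (continuous_pi fun i => Continuous.div (by fun_prop) (by fun_prop) ?_) _
    intro v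
    positivity

theorem simplexRetraction_apply {n : ℕ} (s : stdSimplex ℝ (Fin (n + 1))) :
    simplexRetraction n s = s := by
  ext i
  change (max (s i) 0 + (1 - min (∑ j, max (s j) 0) 1) / (n + 1)) / max (∑ j, max (s j) 0) 1 = s i
  simp

theorem affineSimplex_single {n : ℕ} (s : stdSimplex ℝ (Fin (n + 1))) :
    affineSimplex (fun i => (Pi.single i 1 : Fin (n + 1) → ℝ)) s = s := by
  rw [affineSimplex_apply]
  ext j
  simp [Finset.sum_apply, Pi.single_apply]

variable {Y : Type u} [TopologicalSpace Y]

/-- Singular simplices thus become affine simplices inside a map from a vector space, where the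
affine identities apply and lifting problems are solvable. -/
theorem exists_eq_comp_affineSimplex {n : ℕ} (s : SingularSimplex Y n) :
    s = (s.comp (simplexRetraction n)).comp (affineSimplex fun i => Pi.single i 1) := by
  ext t
  simp [affineSimplex_single, simplexRetraction_apply]

theorem exists_eq_comp_seg (s : SingularSimplex Y 1) :
    ∃ (f : C(Fin 2 → ℝ, Y)) (p q : Fin 2 → ℝ), s = f.comp (seg p q) := by
  refine ⟨s.comp (simplexRetraction 1), Pi.single 0 1, Pi.single 1 1, ?_⟩
  conv_lhs => rw [exists_eq_comp_affineSimplex s]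
  congr 2
  ext i
  fin_cases i <;> rfl

/-- `φ` is a primitive of the integral `1`-cochain `c` up to continuous functions: over every map
from a real vector space to `Y` the sum of `φ` and of the integral of `c` from a base point is
continuous. -/
def IsPrimitive (φ : Y → ℝ) (c : Cochain Y 1) : Prop :=
  ∀ (m : ℕ) (f : C(Fin m → ℝ, Y)) (p : Fin m → ℝ),
    Continuous fun x => φ (f x) + c (f.comp (seg p x))

end

/-! ### Radial maps -/

section Radial

variable {V : Type*} [NormedAddCommGroup V] [NormedSpace ℝ V]

/-- The radial retraction onto the closed ball of radius `r` around `p`. -/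
def ballRetraction (p : V) {r : ℝ} (hr : 0 < r) : C(V, V) where
  toFun x := p + (r / max r ‖x - p‖) • (x - p)
  continuous_toFun := by
    refine continuous_const.add (Continuous.smul (Continuous.div (by fun_prop) (by fun_prop) ?_)
      (by fun_prop))
    intro x
    exact (lt_max_of_lt_left hr).ne'

theorem ballRetraction_apply (p : V) {r : ℝ} (hr : 0 < r) (x : V) :
    ballRetraction p hr x = p + (r / max r ‖x - p‖) • (x - p) := rfl

theorem ballRetraction_mem (p : V) {r : ℝ} (hr : 0 < r) (x : V) :
    ballRetraction p hr x ∈ closedBall p r := by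
  have h : 0 < max r ‖x - p‖ := lt_max_of_lt_left hr
  rw [mem_closedBall, dist_eq_norm, ballRetraction_apply, add_sub_cancel_left, norm_smul,
    Real.norm_of_nonneg (by positivity), div_mul_eq_mul_div, div_le_iff₀ h]
  gcongr
  exact le_max_right _ _

theorem ballRetraction_eq_self {p : V} {r : ℝ} (hr : 0 < r) {x : V} (hx : x ∈ closedBall p r) :
    ballRetraction p hr x = x := by
  rw [mem_closedBall, dist_eq_norm] at hx
  rw [ballRetraction_apply, max_eq_left hx, div_self hr.ne', one_smul, add_sub_cancel]

/-- A deformation of the closed unit ball, relative to its boundary, that expands the ball of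
radius `1 / 2` to the whole ball. -/
def expand : C(V × ℝ, V) where
  -- The second bound keeps the image in the unit ball. Replacing `‖y‖` by its maximum with `1 / 2`
  -- avoids division by zero and is harmless, since the first bound never exceeds `2`.
  toFun z := min (1 + max 0 (min z.2 1)) (1 / max ‖z.1‖ (1 / 2)) • z.1
  continuous_toFun := by
    refine Continuous.smul (Continuous.min (by fun_prop)
      (Continuous.div (by fun_prop) (by fun_prop) ?_)) continuous_fst
    intro z
    positivity

theorem expand_apply (y : V) (s : ℝ) :
    expand (y, s) = min (1 + max 0 (min s 1)) (1 / max ‖y‖ (1 / 2)) • y := rfl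

theorem expand_zero {y : V} (hy : y ∈ closedBall (0 : V) 1) : expand (y, 0) = y := by
  rw [mem_closedBall_zero_iff] at hy
  have h : 1 ≤ 1 / max ‖y‖ (1 / 2) := by
    rw [le_div_iff₀ (by positivity), one_mul]
    exact max_le hy (by norm_num)
  rw [expand_apply, min_eq_left_of_lt zero_lt_one, max_self, add_zero, min_eq_left h, one_smul]

theorem expand_sphere {y : V} (hy : ‖y‖ = 1) (s : ℝ) : expand (y, s) = y := by
  rw [expand_apply, hy, max_eq_left (a := (1 : ℝ)) (by norm_num), div_one, min_eq_right, one_smul]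
  have := le_max_left 0 (min s 1)
  linarith

theorem expand_mem (y : V) (s : ℝ) :
    expand (y, s) ∈ closedBall (0 : V) 1 := by
  rw [mem_closedBall_zero_iff]
  have h : 0 ≤ max 0 (min s 1) := le_max_left _ _
  rw [expand_apply, norm_smul, Real.norm_of_nonneg (by positivity)]
  calc _ ≤ 1 / max ‖y‖ (1 / 2) * ‖y‖ := by gcongr; exact min_le_right _ _
    _ ≤ 1 := by
      rw [div_mul_eq_mul_div, one_mul, div_le_one (by positivity)]
      exact le_max_left _ _

theorem norm_expand_one {y : V} (hy : 1 / 2 ≤ ‖y‖) : ‖expand (y, 1)‖ = 1 := by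
  have h : 1 / max ‖y‖ (1 / 2) ≤ 1 + max 0 (min 1 1) := by
    rw [min_self, max_eq_right zero_le_one, div_le_iff₀ (by positivity)]
    have := le_max_right ‖y‖ (1 / 2)
    linarith
  have h0 : 0 < ‖y‖ := by linarith
  rw [expand_apply, min_eq_right h, max_eq_left hy, norm_smul, norm_div, norm_one, norm_norm]
  field_simp

end Radial

/-! ### CW complexes -/

/-- Continuity of a function that factors through a map from a compact set. -/
theorem continuousOn_of_lift {X S P Z : Type*} [TopologicalSpace X] [T2Space X] [TopologicalSpace S] [TopologicalSpace P]
    [TopologicalSpace Z] {Q : Set P} (hQ : IsCompact Q) (q : C(P, X)) (f : C(S, X)) {T : Set S}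
    (hT : ∀ s ∈ T, f s ∈ q '' Q) {G : S → Z} (g : C(S × P, Z))
    (hg : ∀ s, ∀ y ∈ Q, q y = f s → G s = g (s, y)) : ContinuousOn G T := by
  have : CompactSpace Q := isCompact_iff_compactSpace.1 hQ
  refine continuousOn_iff_isClosed.2 fun F hF => ?_
  -- The preimage of `F` in `T` is the projection of this closed set along the compact factor `Q`,
  -- so no continuous choice of lifts is needed.
  let A : Set (S × Q) := {z | q z.2 = f z.1} ∩ {z | g (z.1, z.2) ∈ F}
  have hA : IsClosed A :=
    (isClosed_eq (by fun_prop) (by fun_prop)).inter (hF.preimage (by fun_prop))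
  refine ⟨Prod.fst '' A, isClosedMap_fst_of_compactSpace _ hA, ?_⟩
  ext s
  constructor
  · rintro ⟨hs, hsT⟩
    obtain ⟨y, hy, hq⟩ := hT s hsT
    refine ⟨⟨(s, ⟨y, hy⟩), ⟨hq, ?_⟩, rfl⟩, hsT⟩
    simpa [hg s y hy hq] using hs
  · rintro ⟨⟨⟨s, y⟩, ⟨hq, hF⟩, rfl⟩, hsT⟩
    refine ⟨?_, hsT⟩
    rw [mem_preimage, hg s y y.2 hq]
    exact hF

section CW

open RelCWComplex

variable {X : Type u} [TopologicalSpace X] [CWComplex (univ : Set X)]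

/-- The characteristic map of a cell, extended to the whole vector space. -/
def charMap (n : ℕ) (i : cell (univ : Set X) n) : C(Fin n → ℝ, X) where
  toFun y := map n i (ballRetraction 0 one_pos y)
  continuous_toFun := (continuousOn n i).comp_continuous (map_continuous _)
    fun y => ballRetraction_mem _ _ y

theorem charMap_eq {n : ℕ} (i : cell (univ : Set X) n) {y : Fin n → ℝ}
    (hy : y ∈ closedBall (0 : Fin n → ℝ) 1) : charMap n i y = map n i y := by
  change map n i (ballRetraction 0 one_pos y) = _
  rw [ballRetraction_eq_self one_pos hy]

theorem symm_map {n : ℕ} (i : cell (univ : Set X) n) {y : Fin n → ℝ}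
    (hy : y ∈ ball (0 : Fin n → ℝ) 1) : (map n i).symm (map n i y) = y :=
  (map n i).left_inv (by rwa [source_eq])

theorem cell_eq_of_mem {n : ℕ} {i j : cell (univ : Set X) n} {x : X} (hi : x ∈ openCell n i)
    (hj : x ∈ openCell n j) : i = j := by
  by_contra h
  exact disjoint_left.1 (disjoint_openCell_of_ne (by simpa using h)) hi hj

variable [T2Space X]

theorem notMem_skeletonLT_of_mem_openCell {n : ℕ} {i : cell (univ : Set X) n} {x : X}
    (hi : x ∈ openCell n i) {m : ℕ} (hm : m ≤ n) :
    x ∉ (skeletonLT (univ : Set X) (m : ℕ∞) : Set X) := by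
  intro h
  exact disjoint_left.1 (disjoint_skeletonLT_openCell (by exact_mod_cast hm)) h hi

theorem mem_skeletonLT_or_mem_openCell {n : ℕ} {x : X}
    (hx : x ∈ (skeletonLT (univ : Set X) ((n + 1 : ℕ) : ℕ∞) : Set X)) :
    x ∈ (skeletonLT (univ : Set X) (n : ℕ∞) : Set X) ∨ ∃ i : cell (univ : Set X) n, x ∈ openCell n i := by
  rw [← CWComplex.iUnion_openCell_eq_skeletonLT] at hx ⊢
  simp only [mem_iUnion, exists_prop] at hx ⊢
  obtain ⟨k, hk, j, hj⟩ := hx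
  have hk : k < n + 1 := by exact_mod_cast hk
  rcases Nat.lt_succ_iff_lt_or_eq.1 hk with h | rfl
  · exact Or.inl ⟨k, by exact_mod_cast h, j, hj⟩
  · exact Or.inr ⟨j, hj⟩

theorem map_mem_skeletonLT_of_norm_eq_one {n : ℕ} (i : cell (univ : Set X) n) {y : Fin n → ℝ}
    (hy : ‖y‖ = 1) : map n i y ∈ (skeletonLT (univ : Set X) (n : ℕ∞) : Set X) :=
  cellFrontier_subset_skeletonLT n i ⟨y, by simpa using hy, rfl⟩

theorem map_mem_skeletonLT_succ {n : ℕ} (i : cell (univ : Set X) n) {y : Fin n → ℝ}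
    (hy : y ∈ closedBall (0 : Fin n → ℝ) 1) :
    map n i y ∈ (skeletonLT (univ : Set X) ((n + 1 : ℕ) : ℕ∞) : Set X) := by
  exact_mod_cast closedCell_subset_skeletonLT n i ⟨y, hy, rfl⟩

/-- Pick a point of `K` in each open cell that meets `K`. A closed cell meets only finitely many
open cells, so every set of chosen points is closed; the chosen points form a compact discrete set,
which is finite. -/
theorem finite_setOf_openCell_inter_nonempty {K : Set X} (hK : IsCompact K) :
    {σ : Σ n, cell (univ : Set X) n | (openCell σ.1 σ.2 ∩ K).Nonempty}.Finite := by
  set S := {σ : Σ n, cell (univ : Set X) n | (openCell σ.1 σ.2 ∩ K).Nonempty}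
  choose x hx using fun σ : S => σ.2
  have hinj : Function.Injective x := by
    intro σ τ h
    by_contra hne
    refine disjoint_left.1 (disjoint_openCell_of_ne (i := σ.1.2) (j := τ.1.2) ?_) (hx σ).1
      (h ▸ (hx τ).1)
    intro h'
    exact hne (Subtype.ext h')
  have hclosed : ∀ T : Set S, IsClosed (x '' T) := by
    intro T
    rw [CWComplex.closed univ _ (subset_univ _)]
    intro n j
    obtain ⟨I, hI⟩ := CWComplex.cellFrontier_subset_finite_openCell n j
    have hfin : {σ : S | σ.1 = ⟨n, j⟩ ∨ ∃ m < n, ∃ i ∈ I m, σ.1 = ⟨m, i⟩}.Finite := by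
      refine Finite.preimage Subtype.val_injective.injOn
        (s := {σ : Σ n, cell (univ : Set X) n | σ = ⟨n, j⟩ ∨ ∃ m < n, ∃ i ∈ I m, σ = ⟨m, i⟩}) ?_
      have h : (⋃ m ∈ Finset.range n, (fun i => (⟨m, i⟩ : Σ n, cell (univ : Set X) n)) ''
          (I m : Set (cell (univ : Set X) m))).Finite :=
        Finite.biUnion (Finset.finite_toSet _) fun m _ => (Finset.finite_toSet _).image _
      refine ((finite_singleton (⟨n, j⟩ : Σ n, cell (univ : Set X) n)).union h).subset ?_
      rintro σ (rfl | ⟨m, hm, i, hi, rfl⟩)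
      · exact Or.inl rfl
      · exact Or.inr (mem_biUnion (by simpa using hm) ⟨i, hi, rfl⟩)
    refine ((hfin.image x).subset ?_).isClosed
    rintro _ ⟨⟨σ, -, rfl⟩, hσ⟩
    refine ⟨σ, ?_, rfl⟩
    rw [← cellFrontier_union_openCell_eq_closedCell] at hσ
    have key : ∀ (m : ℕ) (i : cell (univ : Set X) m), x σ ∈ openCell m i → σ.1 = ⟨m, i⟩ := by
      intro m i h
      by_contra hne
      exact disjoint_left.1 (disjoint_openCell_of_ne (i := σ.1.2) (j := i) hne) (hx σ).1 h
    rcases hσ with h | h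
    · have := hI h
      simp only [mem_iUnion, exists_prop] at this
      obtain ⟨m, hm, i, hi, h⟩ := this
      exact Or.inr ⟨m, hm, i, hi, key m i h⟩
    · exact Or.inl (key n j h)
  have hA : IsCompact (range x) := by
    refine hK.of_isClosed_subset ?_ (range_subset_iff.2 fun σ => (hx σ).2)
    rw [← image_univ]
    exact hclosed univ
  have hd : DiscreteTopology (range x) := by
    refine discreteTopology_iff_forall_isClosed.2 fun T => ?_
    have : T = Subtype.val ⁻¹' (x '' {σ | (⟨x σ, σ, rfl⟩ : range x) ∈ T}) := by
      ext ⟨_, σ, rfl⟩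
      simp [hinj.eq_iff]
    rw [this]
    exact (hclosed _).preimage continuous_subtype_val
  have : Finite (range x) := hA.finite (isDiscrete_iff_discreteTopology.2 hd)
  exact Finite.of_injective_finite_range hinj

/-- A compact subset is contained in a skeleton. -/
theorem exists_subset_skeletonLT {K : Set X} (hK : IsCompact K) :
    ∃ n : ℕ, K ⊆ (skeletonLT (univ : Set X) (n : ℕ∞) : Set X) := by
  obtain ⟨N, hN⟩ := ((finite_setOf_openCell_inter_nonempty hK).image Sigma.fst).bddAbove
  refine ⟨N + 1, fun x hx => ?_⟩
  have hu : x ∈ (univ : Set X) := mem_univ x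
  rw [← CWComplex.iUnion_openCell_eq_complex (C := (univ : Set X))] at hu
  rw [← CWComplex.iUnion_openCell_eq_skeletonLT]
  simp only [mem_iUnion, exists_prop] at hu ⊢
  obtain ⟨m, i, hi⟩ := hu
  have : m ≤ N := hN ⟨⟨m, i⟩, ⟨x, hi, hx⟩, rfl⟩
  exact ⟨m, by exact_mod_cast Nat.lt_succ_of_le this, i, hi⟩

/-- A function on a CW complex is continuous if its restriction to every closed cell is. -/
theorem continuous_of_continuous_comp_charMap {Z : Type*} [TopologicalSpace Z] {g : X → Z}
    (h : ∀ n (i : cell (univ : Set X) n), Continuous (g ∘ charMap n i)) : Continuous g := by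
  refine continuous_iff_isClosed.2 fun F hF => ?_
  rw [CWComplex.closed univ _ (subset_univ _)]
  intro n i
  have : g ⁻¹' F ∩ closedCell n i =
      charMap n i '' (closedBall 0 1 ∩ (g ∘ charMap n i) ⁻¹' F) := by
    ext x
    constructor
    · rintro ⟨hx, y, hy, rfl⟩
      refine ⟨y, ⟨hy, ?_⟩, charMap_eq i hy⟩
      simpa [charMap_eq i hy] using hx
    · rintro ⟨y, ⟨hy, hF⟩, rfl⟩
      exact ⟨hF, y, hy, (charMap_eq i hy).symm⟩
  rw [this]
  exact (((isCompact_closedBall _ _).inter_right (hF.preimage (h n i))).image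
    (map_continuous _)).isClosed

/-- Continuity of a function over a map to the `n`-skeleton with relatively compact image. -/
theorem continuous_of_continuousOn_cells {S Z : Type*} [TopologicalSpace S] [TopologicalSpace Z]
    {n : ℕ} (f : C(S, X))
    (hf : ∀ s, f s ∈ (skeletonLT (univ : Set X) ((n + 1 : ℕ) : ℕ∞) : Set X)) {K : Set X}
    (hK : IsCompact K) (hfK : ∀ s, f s ∈ K) {G : S → Z}
    (h0 : ContinuousOn G {s | f s ∈ (skeletonLT (univ : Set X) (n : ℕ∞) : Set X)})
    (g : cell (univ : Set X) n → C(S × (Fin n → ℝ), Z))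
    (hg : ∀ i s, ∀ y ∈ closedBall (0 : Fin n → ℝ) 1, map n i y = f s → G s = g i (s, y)) :
    Continuous G := by
  -- Only the finitely many cells that meet `K` matter, so the lower skeleton and these closed cells
  -- give a finite closed cover along which continuity can be glued.
  let F := {i : cell (univ : Set X) n | (openCell n i ∩ K).Nonempty}
  have hF : F.Finite := by
    refine Finite.of_finite_image (f := Sigma.mk n)
      ((finite_setOf_openCell_inter_nonempty hK).subset ?_) sigma_mk_injective.injOn
    rintro _ ⟨i, hi, rfl⟩
    exact hi
  have : Finite F := hF
  let A : Option F → Set S := fun o => o.elim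
    (f ⁻¹' (skeletonLT (univ : Set X) (n : ℕ∞) : Set X)) fun i => f ⁻¹' closedCell n i.1
  refine (locallyFinite_of_finite A).continuous ?_ ?_ ?_
  · refine eq_univ_of_forall fun s => mem_iUnion.2 ?_
    rcases mem_skeletonLT_or_mem_openCell (hf s) with h | ⟨i, hi⟩
    · exact ⟨none, h⟩
    · exact ⟨some ⟨i, f s, hi, hfK s⟩, openCell_subset_closedCell _ _ hi⟩
  · rintro (_ | i)
    · exact (skeletonLT (univ : Set X) (n : ℕ∞)).closed.preimage (map_continuous f)
    · exact isClosed_closedCell.preimage (map_continuous f)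
  · rintro (_ | i)
    · exact h0
    · refine continuousOn_of_lift (isCompact_closedBall 0 1) (charMap n i.1) f ?_ (g i.1) ?_
      · rintro s ⟨y, hy, h⟩
        exact ⟨y, hy, (charMap_eq i.1 hy).trans h⟩
      · intro s y hy h
        exact hg i.1 s y hy ((charMap_eq i.1 hy).symm.trans h)

end CW

/-! ### Primitives on cells are primitives along maps to a skeleton -/

section CW

open RelCWComplex

variable {X : Type u} [TopologicalSpace X] [CWComplex (univ : Set X)]

/-- `h` is a primitive of `c` over a closed cell. -/
def IsPrimitiveOnCell (h : X → ℝ) (c : Cochain X 1) (n : ℕ) (i : cell (univ : Set X) n) : Prop :=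
  ∃ θ : C(Fin n → ℝ, ℝ), ∀ y ∈ closedBall (0 : Fin n → ℝ) 1,
    h (map n i y) + c ((charMap n i).comp (seg 0 y)) = θ y

variable {V : Type*} [NormedAddCommGroup V] [NormedSpace ℝ V] {h : X → ℝ} {c : Cochain X 1}

/-- Moving the base point changes the function by a constant, so continuity at `q` may be tested
with base point `q`. -/
theorem continuous_integral_of_forall_continuousAt {Y : Type*} [TopologicalSpace Y] {φ : Y → ℝ}
    {c : Cochain Y 1} (hc : IsCocycle c) (f : C(V, Y))
    (hf : ∀ p, ContinuousAt (fun x => φ (f x) + c (f.comp (seg p x))) p) (p : V) :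
    Continuous fun x => φ (f x) + c (f.comp (seg p x)) := by
  refine continuous_iff_continuousAt.2 fun q => ?_
  have : (fun x => φ (f x) + (c (f.comp (seg p x)) : ℝ)) =
      fun x => (φ (f x) + c (f.comp (seg q x))) + c (f.comp (seg p q)) := by
    ext x
    rw [← hc.triangle f p q x]
    push_cast
    ring
  rw [this]
  exact (hf q).add continuousAt_const

/-- Near `p` the retraction changes neither the points nor the segments from `p`, balls being
convex. This localises the problem to a map with image in that of a small ball. -/
theorem continuousAt_integral_of_ballRetraction {Y : Type*} [TopologicalSpace Y] {φ : Y → ℝ}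
    {c : Cochain Y 1} (f : C(V, Y)) {p : V} {r : ℝ} (hr : 0 < r)
    (hf : Continuous fun x => φ (f.comp (ballRetraction p hr) x) +
      c ((f.comp (ballRetraction p hr)).comp (seg p x))) :
    ContinuousAt (fun x => φ (f x) + c (f.comp (seg p x))) p := by
  refine hf.continuousAt.congr ?_
  filter_upwards [closedBall_mem_nhds p hr] with x hx
  rw [comp_seg_congr (convex_closedBall p r) (mem_closedBall_self hr.le) hx
    (f := f.comp (ballRetraction p hr)) (g := f)
    (fun z hz => congrArg f (ballRetraction_eq_self hr hz))]
  simp [ballRetraction_eq_self hr hx]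

/-- The map lifts through the characteristic map, which is invertible on the open cell, and the cone
formula turns the integral along `f` into one from the centre of the cell. -/
theorem continuous_integral_of_mem_openCell (hc : IsCocycle c) {n : ℕ} {i : cell (univ : Set X) n}
    (hi : IsPrimitiveOnCell h c n i) (f : C(V, X)) (hf : ∀ x, f x ∈ openCell n i) (p : V) :
    Continuous fun x => h (f x) + c (f.comp (seg p x)) := by
  obtain ⟨θ, hθ⟩ := hi
  have htarget : ∀ x, f x ∈ (map n i).target := by
    intro x
    rw [← (map n i).image_source_eq_target, source_eq]
    exact hf x
  let w : C(V, Fin n → ℝ) :=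
    ⟨fun x => (map n i).symm (f x), (continuousOn_symm n i).comp_continuous (map_continuous f) htarget⟩
  have hw : ∀ x, w x ∈ closedBall (0 : Fin n → ℝ) 1 := by
    intro x
    have := (map n i).map_target (htarget x)
    rw [source_eq] at this
    exact ball_subset_closedBall this
  have hfw' : ∀ x, map n i (w x) = f x := fun x => (map n i).right_inv (htarget x)
  have hfw : f = (charMap n i).comp w := by
    ext x
    rw [ContinuousMap.comp_apply, charMap_eq i (hw x), hfw']
  have : (fun x => h (f x) + (c (f.comp (seg p x)) : ℝ)) =
      fun x => θ (w x) - c ((charMap n i).comp (seg 0 (w p))) := by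
    ext x
    rw [← hθ _ (hw x), hfw', hfw, hc.cone _ w 0 p x]
    push_cast
    ring
  rw [this]
  fun_prop

variable [T2Space X]

/-- The radial deformation of the `n`-skeleton that expands the concentric half of every
`n`-cell to the whole cell. -/
def expandCells (n : ℕ) (x : X) (s : ℝ) : X :=
  open Classical in
  if h : ∃ i : cell (univ : Set X) n, x ∈ openCell n i then
    charMap n h.choose (expand ((map n h.choose).symm x, s)) else x

theorem expandCells_of_mem_skeletonLT {n : ℕ} {x : X}
    (hx : x ∈ (skeletonLT (univ : Set X) (n : ℕ∞) : Set X)) (s : ℝ) : expandCells n x s = x := by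
  refine dif_neg ?_
  rintro ⟨i, hi⟩
  exact notMem_skeletonLT_of_mem_openCell hi le_rfl hx

theorem expandCells_map {n : ℕ} (i : cell (univ : Set X) n) {y : Fin n → ℝ}
    (hy : y ∈ closedBall (0 : Fin n → ℝ) 1) (s : ℝ) :
    expandCells n (map n i y) s = charMap n i (expand (y, s)) := by
  rcases (mem_closedBall_zero_iff.1 hy).lt_or_eq with h | h
  · have hb : y ∈ ball (0 : Fin n → ℝ) 1 := mem_ball_zero_iff.2 h
    have hi : ∃ j : cell (univ : Set X) n, map n i y ∈ openCell n j := ⟨i, y, hb, rfl⟩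
    have hij : hi.choose = i := cell_eq_of_mem hi.choose_spec ⟨y, hb, rfl⟩
    rw [expandCells, dif_pos hi, hij, symm_map i hb]
  · rw [expandCells_of_mem_skeletonLT (map_mem_skeletonLT_of_norm_eq_one i h), expand_sphere h,
      charMap_eq i hy]

/-- The radial expansion is a homotopy from `f` to `g`, and by the square identity the two integrals
differ by the values of `c` on the tracks. These stay in single cells, where `h` has a primitive, so
continuity for `g` implies continuity for `f`. -/
theorem continuous_integral_of_expandCells (hc : IsCocycle c) {n : ℕ}
    (hn : ∀ i : cell (univ : Set X) n, IsPrimitiveOnCell h c n i) (f : C(V, X))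
    (hf : ∀ x, f x ∈ (skeletonLT (univ : Set X) ((n + 1 : ℕ) : ℕ∞) : Set X)) {K : Set X}
    (hK : IsCompact K) (hfK : ∀ x, f x ∈ K) (p : V)
    (ih : ∀ g : C(V, X), (∀ x, g x = expandCells n (f x) 1) →
      Continuous fun x => h (g x) + c (g.comp (seg p x))) :
    Continuous fun x => h (f x) + c (f.comp (seg p x)) := by
  choose θ hθ using hn
  let F : C(V × ℝ, X) := ⟨fun z => expandCells n (f z.1) z.2, by
    refine continuous_of_continuousOn_cells (f.comp .fst) (fun z => hf z.1) hK
      (fun z => hfK z.1) ?_ (fun i => ⟨fun z => charMap n i (expand (z.2, z.1.2)), by fun_prop⟩) ?_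
    · refine ContinuousOn.congr (f := fun z => f z.1) (by fun_prop) ?_
      rintro z hz
      exact expandCells_of_mem_skeletonLT hz _
    · rintro i ⟨x, s⟩ y hy hyx
      change map n i y = f x at hyx
      change expandCells n (f x) s = charMap n i (expand (y, s))
      rw [← hyx, expandCells_map i hy]⟩
  have hF0 : F.comp ((ContinuousMap.id V).prodMk (.const V 0)) = f := by
    ext x
    change expandCells n (f x) 0 = f x
    rcases mem_skeletonLT_or_mem_openCell (hf x) with hx | ⟨i, y, hy, hyx⟩
    · exact expandCells_of_mem_skeletonLT hx 0
    · have hy := ball_subset_closedBall hy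
      rw [← hyx, expandCells_map i hy, expand_zero hy, charMap_eq i hy]
  let g : C(V, X) := F.comp ((ContinuousMap.id V).prodMk (.const V 1))
  let track : V → SingularSimplex X 1 := fun x =>
    (F.comp ((ContinuousMap.const ℝ x).prodMk (.id ℝ))).comp (seg 0 1)
  have hsq : ∀ x, c (f.comp (seg p x)) + c (track x) = c (track p) + c (g.comp (seg p x)) := by
    intro x
    have := hc.square F p x
    rwa [hF0] at this
  have htrack0 : ∀ x, f x ∈ (skeletonLT (univ : Set X) (n : ℕ∞) : Set X) → c (track x) = 0 :=
    fun x hx => hc.of_forall_eq fun t => expandCells_of_mem_skeletonLT hx _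
  have htrack : ∀ (i : cell (univ : Set X) n) (x : V), ∀ y ∈ closedBall (0 : Fin n → ℝ) 1,
      map n i y = f x → (c (track x) : ℝ) = c ((charMap n i).comp (seg 0 (expand (y, 1)))) -
        c ((charMap n i).comp (seg 0 y)) := by
    intro i x y hy hyx
    have h1 : F.comp ((ContinuousMap.const ℝ x).prodMk (.id ℝ)) = (charMap n i).comp
        (expand.comp ((ContinuousMap.const ℝ y).prodMk (.id ℝ))) := by
      ext s
      change expandCells n (f x) s = charMap n i (expand (y, s))
      rw [← hyx, expandCells_map i hy]
    have h2 := hc.cone (charMap n i) (expand.comp ((ContinuousMap.const ℝ y).prodMk (.id ℝ))) 0 0 1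
    rw [← h1] at h2
    simp only [track, h2]
    push_cast
    congr 5
    exact expand_zero hy
  -- On a cell with coordinate `y` this function is `θ y - θ (expand (y, 1))`; on the lower skeleton
  -- it is zero.
  have hG : Continuous fun x => h (f x) - h (g x) - (c (track x) : ℝ) := by
    refine continuous_of_continuousOn_cells f hf hK hfK ?_
      (fun i => ⟨fun z => θ i z.2 - θ i (expand (z.2, 1)), by fun_prop⟩) ?_
    · refine ContinuousOn.congr (f := fun _ => (0 : ℝ)) continuousOn_const ?_
      intro x hx
      have : g x = f x := expandCells_of_mem_skeletonLT hx _
      simp [htrack0 x hx, this]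
    · intro i x y hy hyx
      have hgx : g x = map n i (expand (y, 1)) := by
        rw [← charMap_eq i (expand_mem _ _), ← expandCells_map i hy, hyx]
        rfl
      change _ = θ i y - θ i (expand (y, 1))
      rw [htrack i x y hy hyx, ← hθ i y hy, ← hθ i _ (expand_mem y 1), hgx, hyx]
      ring
  have : (fun x => h (f x) + (c (f.comp (seg p x)) : ℝ)) = fun x =>
      (h (g x) + (c (g.comp (seg p x)) : ℝ)) + (h (f x) - h (g x) - (c (track x) : ℝ)) +
        c (track p) := by
    ext x
    have := hsq x
    have : (c (f.comp (seg p x)) : ℝ) = c (track p) + c (g.comp (seg p x)) - c (track x) := by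
      rw [eq_sub_iff_add_eq]
      exact_mod_cast this
    rw [this]
    ring
  rw [this]
  exact ((ih g fun x => rfl).add hG).add continuous_const

/-- A function that is a primitive of a cocycle over every cell of the skeleton is a primitive
over every map to the skeleton. -/
theorem continuous_integral_of_isPrimitiveOnCell [ProperSpace V] (hc : IsCocycle c) (n : ℕ)
    (hn : ∀ m < n, ∀ i : cell (univ : Set X) m, IsPrimitiveOnCell h c m i) (f : C(V, X))
    (hf : ∀ x, f x ∈ (skeletonLT (univ : Set X) (n : ℕ∞) : Set X)) (p : V) :
    Continuous fun x => h (f x) + c (f.comp (seg p x)) := by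
  induction n generalizing f p with
  | zero =>
    have := hf 0
    rw [Nat.cast_zero, CWComplex.skeletonLT_zero_eq_empty] at this
    exact this.elim
  | succ n ih =>
    have ih := ih fun m hm => hn m (hm.trans n.lt_succ_self)
    have hn := hn n n.lt_succ_self
    refine continuous_integral_of_forall_continuousAt hc f (fun p => ?_) p
    have hK : IsCompact (f '' closedBall p 1) := (isCompact_closedBall p 1).image (map_continuous f)
    have hfin : {i : cell (univ : Set X) n | (openCell n i ∩ f '' closedBall p 1).Nonempty}.Finite := by
      refine Finite.of_finite_image (f := Sigma.mk n)
        ((finite_setOf_openCell_inter_nonempty hK).subset ?_) sigma_mk_injective.injOn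
      rintro _ ⟨i, hi, rfl⟩
      exact hi
    rcases mem_skeletonLT_or_mem_openCell (hf p) with hp | ⟨i, hi⟩
    -- If `f p` lies in the lower skeleton, then near `p` the map avoids the concentric half of each
    -- relevant `n`-cell, so the expansion pushes it into the lower skeleton and induction applies.
    · have hev : ∀ᶠ x in 𝓝 p, ∀ i ∈ {i : cell (univ : Set X) n |
          (openCell n i ∩ f '' closedBall p 1).Nonempty},
          f x ∉ charMap n i '' closedBall 0 (1 / 2) := by
        refine (Filter.eventually_all_finite hfin).2 fun i _ => ?_
        have hcl : IsClosed (charMap n i '' closedBall 0 (1 / 2)) :=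
          ((isCompact_closedBall _ _).image (map_continuous _)).isClosed
        refine f.continuous.continuousAt.eventually_mem (hcl.isOpen_compl.mem_nhds ?_)
        · rintro ⟨y, hy, hyp⟩
          have hy' : ‖y‖ < 1 := by
            rw [mem_closedBall_zero_iff] at hy
            linarith
          refine notMem_skeletonLT_of_mem_openCell (i := i) ?_ le_rfl hp
          refine ⟨y, mem_ball_zero_iff.2 hy', ?_⟩
          rw [← hyp, charMap_eq i (mem_closedBall_zero_iff.2 hy'.le)]
      obtain ⟨r, hr, hrb⟩ := nhds_basis_closedBall.eventually_iff.1
        (hev.and (closedBall_mem_nhds p one_pos))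
      refine continuousAt_integral_of_ballRetraction f hr ?_
      have hmem := fun x => hrb (ballRetraction_mem p hr x)
      refine continuous_integral_of_expandCells hc hn (f.comp (ballRetraction p hr)) (fun x => hf _) hK
        (fun x => ⟨_, (hmem x).2, rfl⟩) p fun g hg => ih g (fun x => ?_) p
      rw [hg, ContinuousMap.comp_apply]
      rcases mem_skeletonLT_or_mem_openCell (hf (ballRetraction p hr x)) with hx | ⟨i, hi⟩
      · rwa [expandCells_of_mem_skeletonLT hx]
      · have hnot := (hmem x).1 i ⟨_, hi, _, (hmem x).2, rfl⟩
        obtain ⟨y, hy, hyx⟩ := hi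
        have hy := ball_subset_closedBall hy
        have hy2 : 1 / 2 ≤ ‖y‖ := by
          by_contra! hlt
          exact hnot ⟨y, mem_closedBall_zero_iff.2 hlt.le, by rw [charMap_eq i hy, hyx]⟩
        rw [← hyx, expandCells_map i hy, charMap_eq i (expand_mem _ _)]
        exact map_mem_skeletonLT_of_norm_eq_one i (norm_expand_one hy2)
    -- If `f p` lies in an open `n`-cell, then near `p` the map avoids the lower skeleton and the
    -- other cells, hence stays in that open cell.
    · have hev : ∀ᶠ x in 𝓝 p, f x ∉ (skeletonLT (univ : Set X) (n : ℕ∞) : Set X) ∧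
          ∀ j ∈ {j : cell (univ : Set X) n | (openCell n j ∩ f '' closedBall p 1).Nonempty},
            j ≠ i → f x ∉ closedCell n j := by
        refine Filter.Eventually.and ?_ ((Filter.eventually_all_finite hfin).2 fun j _ => ?_)
        · exact f.continuous.continuousAt.eventually_mem
            ((skeletonLT (univ : Set X) (n : ℕ∞)).closed.isOpen_compl.mem_nhds
              (notMem_skeletonLT_of_mem_openCell hi le_rfl))
        · by_cases hji : j = i
          · simp [hji]
          · simp only [ne_eq, hji, not_false_eq_true, forall_const]
            refine f.continuous.continuousAt.eventually_mem
              (isClosed_closedCell.isOpen_compl.mem_nhds ?_)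
            intro hj
            rw [← cellFrontier_union_openCell_eq_closedCell] at hj
            rcases hj with hj | hj
            · exact notMem_skeletonLT_of_mem_openCell hi le_rfl (cellFrontier_subset_skeletonLT n j hj)
            · exact hji (cell_eq_of_mem hj hi)
      obtain ⟨r, hr, hrb⟩ := nhds_basis_closedBall.eventually_iff.1
        (hev.and (closedBall_mem_nhds p one_pos))
      refine continuousAt_integral_of_ballRetraction f hr ?_
      refine continuous_integral_of_mem_openCell hc (hn i) _ (fun x => ?_) p
      have hx := hrb (ballRetraction_mem p hr x)
      rw [ContinuousMap.comp_apply]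
      rcases mem_skeletonLT_or_mem_openCell (hf (ballRetraction p hr x)) with hs | ⟨j, hj⟩
      · exact (hx.1.1 hs).elim
      · by_cases hji : j = i
        · exact hji ▸ hj
        · exact (hx.1.2 j ⟨_, hj, _, hx.2, rfl⟩ hji (openCell_subset_closedCell _ _ hj)).elim

end CW

/-! ### Construction of primitives by induction over skeleta -/

section CW

open RelCWComplex

variable {X : Type u} [TopologicalSpace X] [T2Space X] [CWComplex (univ : Set X)]
  {h : X → ℝ} {c : Cochain X 1}

theorem IsPrimitiveOnCell.congr {h' : X → ℝ} {n : ℕ} {i : cell (univ : Set X) n}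
    (hi : IsPrimitiveOnCell h c n i)
    (hh : ∀ x ∈ (skeletonLT (univ : Set X) ((n + 1 : ℕ) : ℕ∞) : Set X), h' x = h x) :
    IsPrimitiveOnCell h' c n i := by
  obtain ⟨θ, hθ⟩ := hi
  exact ⟨θ, fun y hy => by rw [hh _ (map_mem_skeletonLT_succ i hy), hθ y hy]⟩

/-- Continuity is known only along maps from vector spaces, so a ball around `y` is pushed radially
to the sphere by `w`. Radius `1 / 2` keeps norms at least `1 / 2`, which is where the expansion ends
on the sphere; the characteristic map then lands in the lower skeleton. -/
theorem continuousOn_integral_sphere (hc : IsCocycle c) {n : ℕ}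
    (hn : ∀ m < n, ∀ i : cell (univ : Set X) m, IsPrimitiveOnCell h c m i)
    (i : cell (univ : Set X) n) :
    ContinuousOn (fun y => h (map n i y) + c ((charMap n i).comp (seg 0 y))) (sphere 0 1) := by
  intro y hy
  have hy : ‖y‖ = 1 := by simpa using hy
  have hr : (0 : ℝ) < 1 / 2 := by norm_num
  let w : C(Fin n → ℝ, Fin n → ℝ) :=
    (expand.comp ((ContinuousMap.id _).prodMk (.const _ 1))).comp (ballRetraction y hr)
  have hw : ∀ x, ‖w x‖ = 1 := by
    intro x
    refine norm_expand_one ?_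
    have := ballRetraction_mem y hr x
    rw [mem_closedBall', dist_eq_norm] at this
    have := norm_sub_norm_le y (ballRetraction y hr x)
    simp only [ContinuousMap.id_apply]
    linarith
  have hmem : ∀ {x : Fin n → ℝ}, ‖x‖ = 1 → x ∈ closedBall (0 : Fin n → ℝ) 1 :=
    fun hx => mem_closedBall_zero_iff.2 hx.le
  have hwx : ∀ x, ‖x‖ = 1 → x ∈ closedBall y (1 / 2) → w x = x := by
    intro x hx hxy
    change expand (ballRetraction y hr x, 1) = x
    rw [ballRetraction_eq_self hr hxy, expand_sphere hx]
  have hcont := continuous_integral_of_isPrimitiveOnCell hc n hn ((charMap n i).comp w)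
    (fun x => by
      rw [ContinuousMap.comp_apply, charMap_eq i (hmem (hw x))]
      exact map_mem_skeletonLT_of_norm_eq_one i (hw x)) y
  refine ((hcont.add (continuous_const (y := (c ((charMap n i).comp (seg 0 (w y))) : ℝ)))
    ).continuousWithinAt (x := y) (s := sphere 0 1)).congr_of_eventuallyEq_of_mem ?_ (by simpa using hy)
  filter_upwards [self_mem_nhdsWithin, mem_nhdsWithin_of_mem_nhds (closedBall_mem_nhds y hr)]
    with x hx hxy
  have hx : ‖x‖ = 1 := by simpa using hx
  rw [Pi.add_apply, hc.cone (charMap n i) w 0 y x, ContinuousMap.comp_apply, hwx x hx hxy, charMap_eq i (hmem hx)]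
  push_cast
  ring

/-- The integral from the centre is continuous on the boundary sphere and extends over the cell by
Tietze. Subtracting the integral from this extension defines `h'` in the open cell. -/
theorem exists_extension_isPrimitiveOnCell (hc : IsCocycle c) (n : ℕ)
    (hn : ∀ m < n, ∀ i : cell (univ : Set X) m, IsPrimitiveOnCell h c m i) :
    ∃ h' : X → ℝ, (∀ x ∈ (skeletonLT (univ : Set X) (n : ℕ∞) : Set X), h' x = h x) ∧
      ∀ m < n + 1, ∀ i : cell (univ : Set X) m, IsPrimitiveOnCell h' c m i := by
  classical
  have hext : ∀ i : cell (univ : Set X) n, ∃ θ : C(Fin n → ℝ, ℝ), ∀ y ∈ sphere 0 1,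
      θ y = h (map n i y) + c ((charMap n i).comp (seg 0 y)) := by
    intro i
    obtain ⟨θ, hθ⟩ := ContinuousMap.exists_restrict_eq isClosed_sphere
      (⟨_, (continuousOn_integral_sphere hc hn i).domRestrict⟩ : C(sphere (0 : Fin n → ℝ) 1, ℝ))
    exact ⟨θ, fun y hy => congrArg (fun f => f ⟨y, hy⟩) hθ⟩
  choose θ hθ using hext
  let h' : X → ℝ := fun x =>
    if hx : ∃ i : cell (univ : Set X) n, x ∈ openCell n i then
      θ hx.choose ((map n hx.choose).symm x) -
        c ((charMap n hx.choose).comp (seg 0 ((map n hx.choose).symm x))) else h x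
  have h'_skel : ∀ x ∈ (skeletonLT (univ : Set X) (n : ℕ∞) : Set X), h' x = h x := by
    intro x hx
    refine dif_neg ?_
    rintro ⟨i, hi⟩
    exact notMem_skeletonLT_of_mem_openCell hi le_rfl hx
  refine ⟨h', h'_skel, fun m hm i => ?_⟩
  rcases Nat.lt_succ_iff_lt_or_eq.1 hm with hmn | rfl
  · exact (hn m hmn i).congr fun x hx =>
      h'_skel x (skeletonLT_mono (by exact_mod_cast Nat.succ_le_of_lt hmn) hx)
  · refine ⟨θ i, fun y hy => ?_⟩
    rcases (mem_closedBall_zero_iff.1 hy).lt_or_eq with hlt | heq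
    · have hb : y ∈ ball (0 : Fin m → ℝ) 1 := mem_ball_zero_iff.2 hlt
      have hi : ∃ j : cell (univ : Set X) m, map m i y ∈ openCell m j := ⟨i, y, hb, rfl⟩
      have hij : hi.choose = i := cell_eq_of_mem hi.choose_spec ⟨y, hb, rfl⟩
      simp only [h']
      rw [dif_pos hi, hij, symm_map i hb, sub_add_cancel]
    · rw [h'_skel _ (map_mem_skeletonLT_of_norm_eq_one i heq), hθ i y (by simpa using heq)]

/-- Each extension leaves the lower skeleton unchanged, so the values at any point stabilise and
define the limit. -/
theorem exists_forall_isPrimitiveOnCell (hc : IsCocycle c) :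
    ∃ h : X → ℝ, ∀ n, ∀ i : cell (univ : Set X) n, IsPrimitiveOnCell h c n i := by
  choose ext hext1 hext2 using fun (n : ℕ) (h : {h : X → ℝ //
    ∀ m < n, ∀ i : cell (univ : Set X) m, IsPrimitiveOnCell h c m i}) =>
      exists_extension_isPrimitiveOnCell hc n h.2
  let H : ∀ n : ℕ, {h : X → ℝ //
      ∀ m < n, ∀ i : cell (univ : Set X) m, IsPrimitiveOnCell h c m i} := fun n =>
    Nat.rec ⟨0, fun m hm => absurd hm m.not_lt_zero⟩ (fun n h => ⟨ext n h, hext2 n h⟩) n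
  have hstep : ∀ n : ℕ, ∀ x ∈ (skeletonLT (univ : Set X) (n : ℕ∞) : Set X),
      (H (n + 1)).1 x = (H n).1 x := fun n => hext1 n (H n)
  have hmono : ∀ n m : ℕ, n ≤ m → ∀ x ∈ (skeletonLT (univ : Set X) (n : ℕ∞) : Set X),
      (H m).1 x = (H n).1 x := by
    intro n m hnm x hx
    induction m, hnm using Nat.le_induction with
    | base => rfl
    | succ m hnm ih => rw [hstep m x (skeletonLT_mono (by exact_mod_cast hnm) hx), ih]
  have hx : ∀ x : X, ∃ n : ℕ, x ∈ (skeletonLT (univ : Set X) (n : ℕ∞) : Set X) := by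
    intro x
    obtain ⟨n, hn⟩ := exists_subset_skeletonLT (isCompact_singleton (x := x))
    exact ⟨n, hn rfl⟩
  choose N hN using hx
  refine ⟨fun x => (H (N x)).1 x, fun n i => ((H (n + 1)).2 n n.lt_succ_self i).congr ?_⟩
  intro x hx
  rcases le_total (N x) (n + 1) with hle | hle
  · exact (hmono _ _ hle x (hN x)).symm
  · exact hmono _ _ hle x hx

/-- Every integral `1`-cocycle on a CW complex has a primitive. -/
theorem exists_isPrimitive (hc : IsCocycle c) : ∃ h : X → ℝ, IsPrimitive h c := by
  obtain ⟨h, hh⟩ := exists_forall_isPrimitiveOnCell hc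
  refine ⟨h, fun m f p => continuous_integral_of_forall_continuousAt hc f (fun p => ?_) p⟩
  refine continuousAt_integral_of_ballRetraction f one_pos ?_
  obtain ⟨n, hn⟩ := exists_subset_skeletonLT
    ((isCompact_closedBall p 1).image (map_continuous f))
  exact continuous_integral_of_isPrimitiveOnCell hc n (fun m _ i => hh m i) _
    (fun x => hn ⟨_, ballRetraction_mem p one_pos x, rfl⟩) p

end CW

/-! ### The exponential map with period `1` -/

/-- The exponential map `ℝ → 𝕋` with kernel `ℤ`. -/
def unitExp : C(ℝ, Circle) := Circle.exp.comp ⟨fun x => 2 * Real.pi * x, by fun_prop⟩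

theorem unitExp_apply (x : ℝ) : unitExp x = Circle.exp (2 * Real.pi * x) := rfl

theorem unitExp_add (x y : ℝ) : unitExp (x + y) = unitExp x * unitExp y := by
  rw [unitExp_apply, mul_add, Circle.exp_add]
  rfl

theorem unitExp_zero : unitExp 0 = 1 := by
  rw [unitExp_apply, mul_zero, Circle.exp_zero]

theorem unitExp_neg (x : ℝ) : unitExp (-x) = (unitExp x)⁻¹ := by
  rw [unitExp_apply, mul_neg, Circle.exp_neg]
  rfl

theorem unitExp_sub (x y : ℝ) : unitExp (x - y) = unitExp x * (unitExp y)⁻¹ := by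
  rw [sub_eq_add_neg, unitExp_add, unitExp_neg]

theorem unitExp_eq_iff {x y : ℝ} : unitExp x = unitExp y ↔ ∃ n : ℤ, x = y + n := by
  have hpi : 2 * Real.pi ≠ 0 := by positivity
  rw [unitExp_apply, unitExp_apply, Circle.exp_eq_exp]
  refine exists_congr fun n => ?_
  constructor
  · intro h
    exact mul_left_cancel₀ hpi (by linarith)
  · rintro rfl
    ring

theorem unitExp_eq_one_iff {x : ℝ} : unitExp x = 1 ↔ ∃ n : ℤ, x = n := by
  rw [← unitExp_zero, unitExp_eq_iff]
  simp

theorem unitExp_add_intCast (x : ℝ) (n : ℤ) : unitExp (x + n) = unitExp x :=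
  unitExp_eq_iff.2 ⟨n, rfl⟩

theorem unitExp_surjective : Function.Surjective unitExp := by
  intro z
  obtain ⟨x, hx⟩ := Circle.exp_surjective z
  refine ⟨x / (2 * Real.pi), ?_⟩
  rw [unitExp_apply, mul_div_cancel₀ _ (by positivity), hx]

theorem exists_lift_unitExp {m : ℕ} (f : C(Fin m → ℝ, Circle)) :
    ∃ g : C(Fin m → ℝ, ℝ), ∀ x, unitExp (g x) = f x := by
  obtain ⟨t, ht⟩ := Circle.exp_surjective (f 0)
  obtain ⟨g, ⟨-, hg⟩, -⟩ := Circle.isCoveringMap_exp.existsUnique_continuousMap_lifts f 0 t ht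
  refine ⟨⟨fun x => g x / (2 * Real.pi), by fun_prop⟩, fun x => ?_⟩
  change Circle.exp (2 * Real.pi * (g x / (2 * Real.pi))) = f x
  rw [mul_div_cancel₀ _ (by positivity)]
  exact congrFun hg x

/-- A continuous function that is constant modulo `ℤ` is constant. -/
theorem eq_of_unitExp_eq {S : Type*} [TopologicalSpace S] [PreconnectedSpace S] {g : S → ℝ}
    (hg : Continuous g) {z : Circle} (h : ∀ s, unitExp (g s) = z) (s t : S) : g s = g t := by
  choose n hn using fun s => unitExp_eq_iff.1 ((h s).trans (h t).symm)
  have hn' : ∀ s, (n s : ℝ) = g s - g t := fun s => by linarith [hn s]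
  have hcont : Continuous n := by
    rw [Int.isClosedEmbedding_coe_real.isEmbedding.continuous_iff]
    have : (Int.cast ∘ n : S → ℝ) = fun s => g s - g t := funext hn'
    rw [this]
    exact hg.sub continuous_const
  have h1 := PreconnectedSpace.constant ‹_› hcont (x := s) (y := t)
  have h2 := hn' s
  rw [h1, hn' t] at h2
  linarith

instance preconnectedSpace_stdSimplex (n : ℕ) : PreconnectedSpace (stdSimplex ℝ (Fin (n + 1))) :=
  isPreconnected_iff_preconnectedSpace.1
    (isPathConnected_stdSimplex (Fin (n + 1))).isConnected.isPreconnected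

/-! ### Cochains of degree `0` and `1` -/

section Cochains

variable {Y : Type u} [TopologicalSpace Y] {Z : Type v} [TopologicalSpace Z]
variable {V : Type*} [AddCommGroup V] [Module ℝ V] [TopologicalSpace V] [IsTopologicalAddGroup V]
  [ContinuousSMul ℝ V]

/-- The pull-back of a cochain. -/
def Cochain.pullback {n : ℕ} (c : Cochain Z n) (f : C(Y, Z)) : Cochain Y n := fun s => c (f.comp s)

theorem coboundary_pullback {n : ℕ} (c : Cochain Z n) (f : C(Y, Z)) :
    coboundary Y n (c.pullback f) = (coboundary Z n c).pullback f := rfl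

theorem IsCocycle.pullback {c : Cochain Z 1} (hc : IsCocycle c) (f : C(Y, Z)) :
    IsCocycle (c.pullback f) := by
  rw [IsCocycle, coboundary_pullback, hc]
  rfl

theorem isCocycle_of_forall_triangle {c : Cochain Y 1}
    (h : ∀ (f : C(Fin 3 → ℝ, Y)) (p q r : Fin 3 → ℝ),
      c (f.comp (seg p q)) + c (f.comp (seg q r)) = c (f.comp (seg p r))) : IsCocycle c := by
  funext s
  change SingularSimplex Y 2 at s
  change ∑ i : Fin 3, (-1 : ℤ) ^ (i : ℕ) * c (s.comp (face i)) = 0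
  rw [exists_eq_comp_affineSimplex s]
  set f := s.comp (simplexRetraction 2)
  set v : Fin 3 → Fin 3 → ℝ := fun i => Pi.single i 1
  have h0 : v ∘ (0 : Fin 3).succAbove = ![v 1, v 2] := by ext i; fin_cases i <;> rfl
  have h1 : v ∘ (1 : Fin 3).succAbove = ![v 0, v 2] := by ext i; fin_cases i <;> rfl
  have h2 : v ∘ (2 : Fin 3).succAbove = ![v 0, v 1] := by ext i; fin_cases i <;> rfl
  have := h f (v 0) (v 1) (v 2)
  simp only [Fin.sum_univ_three, ContinuousMap.comp_assoc]
  rw [affineSimplex_comp_face, affineSimplex_comp_face, affineSimplex_comp_face, h0, h1, h2]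
  simp only [seg] at this
  norm_num
  linarith

theorem coboundary_zero_seg (b : Cochain Y 0) (f : C(V, Y)) (p q : V) :
    coboundary Y 0 b (f.comp (seg p q)) =
      b (ContinuousMap.const _ (f q)) - b (ContinuousMap.const _ (f p)) := by
  change ∑ i : Fin 2, (-1 : ℤ) ^ (i : ℕ) * b ((f.comp (affineSimplex ![p, q])).comp (face i)) = _
  have h0 : (f.comp (affineSimplex ![p, q])).comp (face 0) = ContinuousMap.const _ (f q) := by
    rw [ContinuousMap.comp_assoc, affineSimplex_comp_face]
    ext t
    simp [affineSimplex_apply]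
  have h1 : (f.comp (affineSimplex ![p, q])).comp (face 1) = ContinuousMap.const _ (f p) := by
    rw [ContinuousMap.comp_assoc, affineSimplex_comp_face]
    ext t
    simp [affineSimplex_apply]
  rw [Fin.sum_univ_two, h0, h1]
  simp
  ring

/-- The cochains `c` with `c (σ ∘ s) = ε * c s`. -/
def signedCochains (σ : C(Y, Y)) (ε : ℤ) (n : ℕ) : AddSubgroup (Cochain Y n) where
  carrier := {c | ∀ s : SingularSimplex Y n, c (σ.comp s) = ε * c s}
  zero_mem' := by
    intro s
    simp
  add_mem' := by
    intro c c' hc hc' s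
    have h := hc s
    have h' := hc' s
    simp only [Pi.add_apply, h, h']
    ring
  neg_mem' := by
    intro c hc s
    have h := hc s
    simp only [Pi.neg_apply, h]
    ring

theorem antiInvariantCochains_eq (σ : C(Y, Y)) :
    antiInvariantCochains σ = signedCochains σ (-1) := by
  funext n
  ext c
  simp [antiInvariantCochains, signedCochains]

end Cochains

/-! ### Circle-valued maps represented by cocycles -/

section

variable {E : Type v} [TopologicalSpace E] {X : Type u} [TopologicalSpace X]
  {τ : C(E, E)} {ι : C(X, X)} {ε : ℤ} {θ : Circle →* Circle}

/-- The `1`-cochain `c` on `E × X` represents the class of the map `f` to the circle. -/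
def Represents (τ : C(E, E)) (ι : C(X, X)) (ε : ℤ) (f : C(X, Circle)) (c : Cochain (E × X) 1) :
    Prop :=
  ∃ φ : E × X → ℝ, (∀ y, φ (diagonal τ ι y) = ε * φ y) ∧ (∀ y, unitExp (φ y) = f y.2) ∧
    IsPrimitive φ c

theorem IsPrimitive.add {Y : Type*} [TopologicalSpace Y] {φ ψ : Y → ℝ} {c d : Cochain Y 1}
    (hφ : IsPrimitive φ c) (hψ : IsPrimitive ψ d) : IsPrimitive (φ + ψ) (c + d) := by
  intro m f p
  refine ((hφ m f p).add (hψ m f p)).congr fun x => ?_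
  simp only [Pi.add_apply]
  push_cast
  ring

theorem IsPrimitive.neg {Y : Type*} [TopologicalSpace Y] {φ : Y → ℝ} {c : Cochain Y 1}
    (hφ : IsPrimitive φ c) : IsPrimitive (-φ) (-c) := by
  intro m f p
  refine (hφ m f p).neg.congr fun x => ?_
  simp only [Pi.neg_apply]
  push_cast
  ring

theorem Represents.mul {f g : C(X, Circle)} {c d : Cochain (E × X) 1}
    (hf : Represents τ ι ε f c) (hg : Represents τ ι ε g d) :
    Represents τ ι ε (f * g) (c + d) := by
  obtain ⟨φ, h1, h2, h3⟩ := hf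
  obtain ⟨ψ, k1, k2, k3⟩ := hg
  refine ⟨φ + ψ, fun y => ?_, fun y => ?_, h3.add k3⟩
  · rw [Pi.add_apply, Pi.add_apply, h1, k1, mul_add]
  · rw [Pi.add_apply, unitExp_add, h2, k2, ContinuousMap.mul_apply]

theorem Represents.inv {f : C(X, Circle)} {c : Cochain (E × X) 1}
    (hf : Represents τ ι ε f c) : Represents τ ι ε f⁻¹ (-c) := by
  obtain ⟨φ, h1, h2, h3⟩ := hf
  refine ⟨-φ, fun y => ?_, fun y => ?_, h3.neg⟩
  · rw [Pi.neg_apply, Pi.neg_apply, h1, mul_neg]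
  · rw [Pi.neg_apply, unitExp_neg, h2, ContinuousMap.inv_apply]

theorem represents_unitExp_comp {g : C(X, ℝ)} (hg : ∀ x, g (ι x) = ε * g x) :
    Represents τ ι ε (unitExp.comp g) 0 := by
  refine ⟨fun y => g y.2, fun y => hg y.2, fun y => rfl, fun m f p => ?_⟩
  simp only [Pi.zero_apply, Int.cast_zero, add_zero]
  fun_prop

/-- A cocycle that represents the constant map `1` is a coboundary. -/
theorem Represents.exists_coboundary_eq {c : Cochain (E × X) 1} (hc : IsCocycle c)
    (h : Represents τ ι ε 1 c) :
    ∃ b ∈ signedCochains (diagonal τ ι) ε 0, coboundary (E × X) 0 b = c := by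
  obtain ⟨φ, h1, h2, h3⟩ := h
  -- Over the constant map `1` the function `φ` takes integer values; its negative is the required
  -- `0`-cochain.
  choose n hn using fun y => unitExp_eq_one_iff.1 (h2 y)
  refine ⟨fun s => -n (s default), ?_, ?_⟩
  · intro s
    have : (n (diagonal τ ι (s default)) : ℝ) = ε * n (s default) := by rw [← hn, ← hn, h1]
    have : n (diagonal τ ι (s default)) = ε * n (s default) := by exact_mod_cast this
    change -n (diagonal τ ι (s default)) = ε * -n (s default)
    rw [this, mul_neg]
  · funext s
    obtain ⟨f, p, q, rfl⟩ := exists_eq_comp_seg s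
    rw [coboundary_zero_seg]
    -- A continuous integer-valued function is constant; comparing its values at `p` and `q`
    -- computes `c` on the segment.
    have := eq_of_unitExp_eq (h3 2 f p) (z := 1)
      (fun x => by rw [unitExp_add_intCast, h2]; rfl) p q
    rw [hc.seg_self, Int.cast_zero, add_zero, hn, hn] at this
    have : n (f p) = n (f q) + c (f.comp (seg p q)) := by exact_mod_cast this
    simp only [ContinuousMap.const_apply]
    linarith

/-- A map that is represented by a coboundary lifts to `ℝ`. -/
theorem Represents.exists_lift [T2Space X] [CWComplex (univ : Set X)] [PathConnectedSpace E]
    {f : C(X, Circle)} {b : Cochain (E × X) 0} (hb : b ∈ signedCochains (diagonal τ ι) ε 0)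
    (h : Represents τ ι ε f (coboundary (E × X) 0 b)) :
    ∃ g : C(X, ℝ), (∀ x, g (ι x) = ε * g x) ∧ ∀ x, unitExp (g x) = f x := by
  obtain ⟨φ, h1, h2, h3⟩ := h
  -- Adding `b` cancels the jumps of `φ`, so `ψ` is continuous along every map from a vector space.
  let ψ : E × X → ℝ := fun y => φ y + b (ContinuousMap.const _ y)
  have hψexp : ∀ y, unitExp (ψ y) = f y.2 := fun y => by rw [unitExp_add_intCast, h2]
  have hψσ : ∀ y, ψ (diagonal τ ι y) = ε * ψ y := by
    intro y
    have := hb (ContinuousMap.const _ y)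
    rw [ContinuousMap.comp_const] at this
    simp only [ψ]
    rw [h1, this]
    push_cast
    ring
  have hcont : ∀ (m : ℕ) (k : C(Fin m → ℝ, E × X)), Continuous fun x => ψ (k x) := by
    intro m k
    refine ((h3 m k 0).add (continuous_const (y := (b (ContinuousMap.const _ (k 0)) : ℝ)))).congr
      fun x => ?_
    simp only [ψ, Pi.add_apply]
    rw [coboundary_zero_seg]
    push_cast
    ring
  -- Along a path in `E`, `ψ` is a continuous lift of the constant `f x`, hence constant; so `ψ`
  -- descends to `X`.
  have hE : ∀ (e e' : E) (x : X), ψ (e, x) = ψ (e', x) := by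
    intro e e' x
    let γ := PathConnectedSpace.somePath e e'
    have := eq_of_unitExp_eq
      (hcont 1 ⟨fun t => (γ.extend (t 0), x), by fun_prop⟩) (z := f x) (fun t => hψexp _)
      (fun _ => 0) (fun _ => 1)
    simpa using this
  obtain ⟨e⟩ := (inferInstance : Nonempty E)
  refine ⟨⟨fun x => ψ (e, x), ?_⟩, fun x => ?_, fun x => hψexp _⟩
  · refine continuous_of_continuous_comp_charMap fun n i => ?_
    exact hcont n ((ContinuousMap.const _ e).prodMk (charMap n i))
  · change ψ (e, ι x) = ε * ψ (e, x)
    rw [hE e (τ e) (ι x)]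
    exact hψσ (e, x)

/-- An equivariant lift of a map to the circle, which need not be continuous. -/
theorem exists_equivariant_lift {Y : Type*} {σ : Y → Y} (hσ : Function.Involutive σ)
    (hfree : ∀ y, σ y ≠ y) (hε : ε * ε = 1) (hθ : ∀ x : ℝ, θ (unitExp x) = unitExp (ε * x))
    {F : Y → Circle} (hF : ∀ y, F (σ y) = θ (F y)) :
    ∃ φ : Y → ℝ, (∀ y, φ (σ y) = ε * φ y) ∧ ∀ y, unitExp (φ y) = F y := by
  classical
  have hε' : (ε : ℝ) * ε = 1 := by exact_mod_cast hε
  choose l hl using fun y => unitExp_surjective (F y)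
  -- One point is chosen in each orbit. There the lift is arbitrary; at the other point, distinct by
  -- freeness, it is forced by the sign.
  let rep : Y → Y := fun y => (Quotient.mk (orbitSetoid σ hσ) y).out
  have hrep : ∀ y, rep y = y ∨ rep y = σ y := by
    intro y
    have h : (orbitSetoid σ hσ).r (rep y) y := Quotient.mk_out (s := orbitSetoid σ hσ) y
    exact h.imp id fun h => by rw [← hσ (rep y), h]
  have hrepσ : ∀ y, rep (σ y) = rep y := by
    intro y
    have : Quotient.mk (orbitSetoid σ hσ) (σ y) = Quotient.mk (orbitSetoid σ hσ) y :=
      Quotient.sound (s := orbitSetoid σ hσ) (Or.inr (hσ y))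
    simp only [rep, this]
  refine ⟨fun y => if rep y = y then l y else ε * l (σ y), fun y => ?_, fun y => ?_⟩
  · simp only [hrepσ, hσ y]
    rcases hrep y with h | h
    · rw [if_pos h, if_neg (by rw [h]; exact (hfree y).symm)]
    · rw [if_pos h, if_neg (by rw [h]; exact hfree y), ← mul_assoc, hε', one_mul]
  · dsimp only
    split_ifs
    · exact hl y
    · rw [← hθ, hl, ← hF, hσ]

/-- Every equivariant map to the circle is represented by a cocycle. -/
theorem exists_represents (hτ : IsUniversalFree τ) (hι : Function.Involutive ι) (hε : ε * ε = 1)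
    (hθ : ∀ x : ℝ, θ (unitExp x) = unitExp (ε * x)) {f : C(X, Circle)} (hf : IsEquivariant ι θ f) :
    ∃ c ∈ signedCochains (diagonal τ ι) ε 1, IsCocycle c ∧ Represents τ ι ε f c := by
  have hfree : ∀ y : E × X, diagonal τ ι y ≠ y := by
    rintro ⟨e, x⟩ h
    obtain ⟨U, -, heU, hU⟩ := hτ.exists_disjoint e
    exact disjoint_left.1 hU heU ⟨e, heU, congrArg Prod.fst h⟩
  obtain ⟨φ, hφσ, hφ⟩ := exists_equivariant_lift (F := fun y : E × X => f y.2)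
    (diagonal_involutive hτ.involutive hι) hfree hε hθ (fun y => hf y.2)
  -- The change of a continuous lift of `f` along `s` minus the change of `φ` is an integer,
  -- independent of how `s` is written as a segment and of the lift, because two lifts differ by a
  -- constant.
  have key : ∀ s : SingularSimplex (E × X) 1, ∃ n : ℤ, ∀ (m : ℕ) (k : C(Fin m → ℝ, E × X))
      (p q : Fin m → ℝ) (t : C(Fin m → ℝ, ℝ)), s = k.comp (seg p q) →
        (∀ x, unitExp (t x) = f (k x).2) → (n : ℝ) = t q - t p - (φ (k q) - φ (k p)) := by
    intro s
    obtain ⟨k₀, p₀, q₀, hs₀⟩ := exists_eq_comp_seg s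
    obtain ⟨t₀, ht₀⟩ := exists_lift_unitExp (f.comp (ContinuousMap.snd.comp k₀))
    have hint : unitExp (t₀ q₀ - t₀ p₀ - (φ (k₀ q₀) - φ (k₀ p₀))) = 1 := by
      rw [unitExp_sub, unitExp_sub, unitExp_sub, ht₀, ht₀, hφ, hφ]
      exact mul_inv_cancel _
    obtain ⟨n, hn⟩ := unitExp_eq_one_iff.1 hint
    refine ⟨n, fun m k p q t hs ht => ?_⟩
    rw [← hn]
    have hkk : ∀ z, k₀ (seg p₀ q₀ z) = k (seg p q z) := fun z => by
      have := hs₀.symm.trans hs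
      exact congrArg (fun s => s z) this
    let v : Fin 2 → stdSimplex ℝ (Fin 2) := fun i => stdSimplex.vertex i
    have hv0 : ∀ {m : ℕ} (p q : Fin m → ℝ), seg p q (v 0) = p := by
      intro m p q
      simp [seg_apply, v]
    have hv1 : ∀ {m : ℕ} (p q : Fin m → ℝ), seg p q (v 1) = q := by
      intro m p q
      simp [seg_apply, v]
    have hconst := eq_of_unitExp_eq (S := stdSimplex ℝ (Fin 2))
      (g := fun z => t₀ (seg p₀ q₀ z) - t (seg p q z)) (by fun_prop) (z := 1) (fun z => by
        rw [unitExp_sub, ht₀, ht, ContinuousMap.comp_apply, ContinuousMap.comp_apply, hkk]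
        exact mul_inv_cancel _) (v 0) (v 1)
    have h0 := hkk (v 0)
    have h1 := hkk (v 1)
    simp only [hv0, hv1] at hconst h0 h1
    rw [h0, h1]
    linarith
  choose c hc using key
  have hc' : ∀ {m : ℕ} (k : C(Fin m → ℝ, E × X)), ∃ t : C(Fin m → ℝ, ℝ),
      ∀ p q, (c (k.comp (seg p q)) : ℝ) = t q - t p - (φ (k q) - φ (k p)) := by
    intro m k
    obtain ⟨t, ht⟩ := exists_lift_unitExp (f.comp (ContinuousMap.snd.comp k))
    exact ⟨t, fun p q => hc _ m k p q t rfl ht⟩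
  refine ⟨c, ?_, isCocycle_of_forall_triangle fun k p q r => ?_, φ, hφσ, hφ, fun m k p => ?_⟩
  · intro s
    obtain ⟨k, p, q, rfl⟩ := exists_eq_comp_seg s
    obtain ⟨t, ht⟩ := exists_lift_unitExp (f.comp (ContinuousMap.snd.comp k))
    have h1 := hc _ 2 k p q t rfl ht
    -- Multiplying a lift along `k` by `ε` gives a lift along the translate of `k`.
    have h2 := hc _ 2 ((diagonal τ ι).comp k) p q ⟨fun x => ε * t x, by fun_prop⟩ rfl (fun x => by
      change unitExp (ε * t x) = _
      rw [← hθ, ht]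
      exact (hf _).symm)
    simp only [ContinuousMap.coe_mk, ContinuousMap.comp_apply] at h2
    rw [hφσ, hφσ] at h2
    have : (c ((diagonal τ ι).comp (k.comp (seg p q))) : ℝ) = ε * c (k.comp (seg p q)) := by
      rw [← ContinuousMap.comp_assoc, h2, h1]
      ring
    exact_mod_cast this
  · obtain ⟨t, ht⟩ := hc' k
    have : (c (k.comp (seg p q)) : ℝ) + c (k.comp (seg q r)) = c (k.comp (seg p r)) := by
      rw [ht, ht, ht]
      ring
    exact_mod_cast this
  · obtain ⟨t, ht⟩ := hc' k
    refine (t.continuous.sub (continuous_const (y := t p - φ (k p)))).congr fun x => ?_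
    rw [ht, Pi.sub_apply]
    ring

end

/-! ### From cocycles to circle-valued maps, and the group isomorphism -/

section

variable {E : Type v} [TopologicalSpace E] {X : Type u} [TopologicalSpace X]
  {τ : C(E, E)} {ι : C(X, X)} {ε : ℤ} {θ : Circle →* Circle}

/-- A cocycle on `E × X` has a primitive that is exact along `E`, if `E` is contractible. -/
theorem exists_isPrimitive_prod [ContractibleSpace E] [T2Space X] [CWComplex (univ : Set X)]
    {c : Cochain (E × X) 1} (hc : IsCocycle c) :
    ∃ φ : E × X → ℝ, IsPrimitive φ c ∧
      ∀ (f : C(Fin 1 → ℝ, E)) (x : X) (p q : Fin 1 → ℝ),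
        φ (f q, x) + c ((f.prodMk (.const _ x)).comp (seg p q)) = φ (f p, x) := by
  obtain ⟨e, ⟨H⟩⟩ := id_nullhomotopic E
  let c₀ := c.pullback ((ContinuousMap.const X e).prodMk (.id X))
  have hc₀ : IsCocycle c₀ := hc.pullback _
  obtain ⟨h, hh⟩ := exists_isPrimitive hc₀
  -- The path from a point to the slice `{e} × X` given by the contraction of `E`.
  let track : E × X → SingularSimplex (E × X) 1 := fun y =>
    (⟨fun t : ℝ => (H (projIcc 0 1 zero_le_one t, y.1), y.2), by fun_prop⟩ : C(ℝ, E × X)).comp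
      (seg 0 1)
  have key : ∀ {m : ℕ} (f : C(Fin m → ℝ, E × X)) (p q : Fin m → ℝ),
      c (f.comp (seg p q)) + c (track (f q)) =
        c (track (f p)) + c₀ ((ContinuousMap.snd.comp f).comp (seg p q)) := by
    intro m f p q
    let F : C((Fin m → ℝ) × ℝ, E × X) :=
      ⟨fun z => (H (projIcc 0 1 zero_le_one z.2, (f z.1).1), (f z.1).2), by fun_prop⟩
    have h0 : F.comp ((ContinuousMap.id _).prodMk (.const _ 0)) = f := by
      ext x <;> simp [F]
    have h1 : F.comp ((ContinuousMap.id _).prodMk (.const _ 1)) =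
        ((ContinuousMap.const X e).prodMk (.id X)).comp (ContinuousMap.snd.comp f) := by
      ext x <;> simp [F]
    have := hc.square F p q
    rw [h0, h1] at this
    exact this
  -- Integrate along the track, then use the primitive on the slice. The term from `h` is constant
  -- along `E`, so the second claim holds exactly.
  refine ⟨fun y => h y.2 + c (track y), fun m f p => ?_, fun f x p q => ?_⟩
  · refine ((hh m (ContinuousMap.snd.comp f) p).add
      (continuous_const (y := (c (track (f p)) : ℝ)))).congr fun x => ?_
    have : (c (f.comp (seg p x)) : ℝ) + c (track (f x)) =
        c (track (f p)) + c₀ ((ContinuousMap.snd.comp f).comp (seg p x)) := by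
      exact_mod_cast key f p x
    simp only [Pi.add_apply, ContinuousMap.comp_apply, ContinuousMap.snd_apply]
    linarith
  · have h1 := key (f.prodMk (.const _ x)) p q
    have h2 : c₀ ((ContinuousMap.snd.comp (f.prodMk (.const _ x))).comp (seg p q)) = 0 :=
      hc₀.of_forall_eq fun t => rfl
    rw [h2] at h1
    have : (c ((f.prodMk (.const _ x)).comp (seg p q)) : ℝ) + c (track (f q, x)) =
        c (track (f p, x)) := by
      exact_mod_cast h1.trans (add_zero _)
    linarith

/-- Every equivariant cocycle represents an equivariant map to the circle. -/
theorem exists_represented [T2Space X] [CWComplex (univ : Set X)] (hτ : IsUniversalFree τ)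
    (hι : Function.Involutive ι) (hε : ε * ε = 1)
    (hθ : ∀ x : ℝ, θ (unitExp x) = unitExp (ε * x)) {c : Cochain (E × X) 1}
    (hcσ : c ∈ signedCochains (diagonal τ ι) ε 1) (hc : IsCocycle c) :
    ∃ f : C(X, Circle), IsEquivariant ι θ f ∧ Represents τ ι ε f c := by
  have := hτ.contractible
  have hε' : (ε : ℝ) * ε = 1 := by exact_mod_cast hε
  obtain ⟨φ₀, h1, h2⟩ := exists_isPrimitive_prod hc
  have hσσ := diagonal_involutive hτ.involutive hι
  -- Averaging over the involution makes the primitive equivariant.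
  let φ : E × X → ℝ := fun y => (φ₀ y + ε * φ₀ (diagonal τ ι y)) / 2
  have hφσ : ∀ y, φ (diagonal τ ι y) = ε * φ y := by
    intro y
    simp only [φ, hσσ y]
    linear_combination (-(φ₀ (diagonal τ ι y)) / 2) * hε'
  have hcε : ∀ s, (c ((diagonal τ ι).comp s) : ℝ) = ε * c s := by
    intro s
    rw [hcσ s]
    push_cast
    rfl
  have hφ : IsPrimitive φ c := by
    intro m f p
    refine (((h1 m f p).add ((h1 m ((diagonal τ ι).comp f) p).const_mul (ε : ℝ))).div_const
      2).congr fun x => ?_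
    rw [Pi.add_apply, ContinuousMap.comp_assoc, hcε]
    simp only [φ, ContinuousMap.comp_apply]
    linear_combination ((c (f.comp (seg p x)) : ℝ) / 2) * hε'
  -- Averaging could produce half-integers, but by the sign rule for `c` and `ε * ε = 1` both
  -- summands change by the same integer along a path in `E`.
  have hφE : ∀ (e e' : E) (x : X), unitExp (φ (e, x)) = unitExp (φ (e', x)) := by
    intro e e' x
    let γ := PathConnectedSpace.somePath e e'
    let f : C(Fin 1 → ℝ, E) := ⟨fun t => γ.extend (t 0), by fun_prop⟩
    have h3 := h2 f x (fun _ => 0) (fun _ => 1)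
    have h4 := h2 (τ.comp f) (ι x) (fun _ => 0) (fun _ => 1)
    have h5 := hcε ((f.prodMk (.const _ x)).comp (seg (fun _ => 0) (fun _ => 1)))
    have h6 : (diagonal τ ι).comp ((f.prodMk (.const _ x)).comp (seg (fun _ => 0) (fun _ => 1))) =
        ((τ.comp f).prodMk (.const _ (ι x))).comp (seg (fun _ => 0) (fun _ => 1)) := rfl
    rw [h6] at h5
    rw [h5] at h4
    have h7 : f (fun _ => 0) = e := by simp [f]
    have h8 : f (fun _ => 1) = e' := by simp [f]
    simp only [ContinuousMap.comp_apply, h7, h8] at h3 h4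
    refine unitExp_eq_iff.2 ⟨c ((f.prodMk (.const _ x)).comp (seg (fun _ => 0) (fun _ => 1))), ?_⟩
    change (φ₀ (e, x) + ε * φ₀ (τ e, ι x)) / 2 = (φ₀ (e', x) + ε * φ₀ (τ e', ι x)) / 2 + _
    rw [← h3, ← h4]
    linear_combination
      ((c ((f.prodMk (.const _ x)).comp (seg (fun _ => 0) (fun _ => 1))) : ℝ) / 2) * hε'
  obtain ⟨e⟩ := (inferInstance : Nonempty E)
  refine ⟨⟨fun x => unitExp (φ (e, x)), ?_⟩, fun x => ?_, φ, hφσ, fun y => hφE _ _ _, hφ⟩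
  · refine continuous_of_continuous_comp_charMap fun n i => ?_
    refine (unitExp.continuous.comp
      (hφ n ((ContinuousMap.const _ e).prodMk (charMap n i)) 0)).congr fun y => ?_
    exact unitExp_add_intCast _ _
  · change unitExp (φ (e, ι x)) = θ (unitExp (φ (e, x)))
    rw [hφE e (τ e) (ι x), hθ, ← hφσ]
    rfl

/-- Equivariantly homotopic maps to the circle differ by the exponential of an equivariant
function. -/
theorem homotopicWith_isEquivariant_iff (hθ : ∀ x : ℝ, θ (unitExp x) = unitExp (ε * x))
    {f g : C(X, Circle)} (hf : IsEquivariant ι θ f) :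
    ContinuousMap.HomotopicWith f g (IsEquivariant ι θ) ↔
      ∃ k : C(X, ℝ), (∀ x, k (ι x) = ε * k x) ∧ ∀ x, g x = f x * unitExp (k x) := by
  constructor
  · rintro ⟨F⟩
    -- Dividing by the initial stage makes the homotopy start at `1`, so it lifts to `ℝ` starting at
    -- `0`.
    let H : C(unitInterval × X, Circle) := ⟨fun z => F z * (F (0, z.2))⁻¹, by fun_prop⟩
    have H0 : ∀ x, H (0, x) = Circle.exp ((0 : C(X, ℝ)) x) := by
      intro x
      simp [H]
    have hpi : 2 * Real.pi ≠ 0 := by positivity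
    let L := Circle.isCoveringMap_exp.liftHomotopy H 0 H0
    let K : C(unitInterval × X, ℝ) := ⟨fun z => L z / (2 * Real.pi), by fun_prop⟩
    have hK : ∀ z, unitExp (K z) = H z := by
      intro z
      change Circle.exp (2 * Real.pi * (L z / (2 * Real.pi))) = _
      rw [mul_div_cancel₀ _ hpi]
      exact congrFun (Circle.isCoveringMap_exp.liftHomotopy_lifts H 0 H0) z
    have hK0 : ∀ x, K (0, x) = 0 := by
      intro x
      change L (0, x) / (2 * Real.pi) = 0
      rw [Circle.isCoveringMap_exp.liftHomotopy_zero H 0 H0 x]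
      simp
    have hFθ : ∀ t x, F (t, ι x) = θ (F (t, x)) := fun t x => F.prop t x
    have hH : ∀ t x, H (t, ι x) = θ (H (t, x)) := by
      intro t x
      simp only [H, ContinuousMap.coe_mk, map_mul, map_inv, hFθ]
    refine ⟨⟨fun x => K (1, x), by fun_prop⟩, fun x => ?_, fun x => ?_⟩
    -- The failure of equivariance of the lift is continuous in `t`, integral, and zero at time `0`.
    · have := eq_of_unitExp_eq (S := unitInterval) (g := fun t => K (t, ι x) - ε * K (t, x))
        (by fun_prop) (z := 1) (fun t => by
          rw [unitExp_sub, hK, ← hθ, hK, hH]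
          exact mul_inv_cancel _) 1 0
      simp only [hK0, mul_zero, sub_zero] at this
      exact sub_eq_zero.1 this
    · have : unitExp (K (1, x)) = g x * (f x)⁻¹ := by
        rw [hK]
        simp [H]
      change g x = f x * unitExp (K (1, x))
      rw [this, mul_comm, inv_mul_cancel_right]
  · rintro ⟨k, hk, hgk⟩
    refine ⟨⟨⟨⟨fun z => f z.2 * unitExp (z.1 * k z.2), by fun_prop⟩, fun x => ?_, fun x => ?_⟩,
      fun t x => ?_⟩⟩
    · simp [unitExp_zero]
    · simp [hgk]
    · change f (ι x) * unitExp (t * k (ι x)) = θ (f x * unitExp (t * k x))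
      rw [map_mul θ, hθ, hf x, hk]
      congr 2
      ring

theorem mem_cocycles_signedCochains {Y : Type*} [TopologicalSpace Y] {σ : C(Y, Y)}
    {c : Cochain Y 1} :
    c ∈ cocycles (signedCochains σ ε) 1 ↔ c ∈ signedCochains σ ε 1 ∧ IsCocycle c := Iff.rfl

theorem signedCohomology_mk_eq_iff {Y : Type*} [TopologicalSpace Y] {σ : C(Y, Y)}
    {c d : cocycles (signedCochains σ ε) 1} :
    (c : Cohomology (signedCochains σ ε) 1) = d ↔
      ∃ b ∈ signedCochains σ ε 0, coboundary Y 0 b = -c.1 + d.1 := by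
  rw [QuotientAddGroup.eq, AddSubgroup.mem_addSubgroupOf]
  rfl

/-- The group of equivariant homotopy classes of maps to the circle is isomorphic to the
equivariant cohomology group of degree `1` with coefficients in `ℤ` with the sign `ε`. -/
theorem nonempty_signedCohomology_addEquiv [T2Space X] [CWComplex (univ : Set X)]
    (hτ : IsUniversalFree τ) (hι : Function.Involutive ι) (hε : ε * ε = 1)
    (hθ : ∀ x : ℝ, θ (unitExp x) = unitExp (ε * x)) :
    Nonempty (Cohomology (signedCochains (diagonal τ ι) ε) 1 ≃+ Additive (HomotopyClasses ι θ)) := by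
  have := hτ.contractible
  choose c hcσ hc hrep using fun f : equivariantMaps ι θ => exists_represents hτ hι hε hθ f.2
  let C : equivariantMaps ι θ → cocycles (signedCochains (diagonal τ ι) ε) 1 :=
    fun f => ⟨c f, mem_cocycles_signedCochains.2 ⟨hcσ f, hc f⟩⟩
  -- Two cocycles representing `f` differ by one representing `1`, a coboundary. So the class does
  -- not depend on the chosen cocycle, and the assignment is a homomorphism.
  have huniq : ∀ (f : equivariantMaps ι θ) (d : cocycles (signedCochains (diagonal τ ι) ε) 1),
      Represents τ ι ε f.1 d.1 → (C f : Cohomology (signedCochains (diagonal τ ι) ε) 1) = d := by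
    intro f d hd
    refine signedCohomology_mk_eq_iff.2 ?_
    have h := (hrep f).inv.mul hd
    rw [inv_mul_cancel] at h
    exact h.exists_coboundary_eq (mem_cocycles_signedCochains.1 (-C f + d).2).2
  let Ψ : equivariantMaps ι θ →*
      Multiplicative (Cohomology (signedCochains (diagonal τ ι) ε) 1) :=
    MonoidHom.mk' (fun f => Multiplicative.ofAdd (C f : Cohomology _ 1)) fun f g => by
      rw [huniq (f * g) (C f + C g) ((hrep f).mul (hrep g))]
      rfl
  have hsurj : Function.Surjective Ψ := by
    intro z
    obtain ⟨d, hd⟩ := QuotientAddGroup.mk_surjective (Multiplicative.toAdd z)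
    obtain ⟨hdσ, hdc⟩ := mem_cocycles_signedCochains.1 d.2
    obtain ⟨f, hf, hfd⟩ := exists_represented hτ hι hε hθ hdσ hdc
    exact ⟨⟨f, hf⟩, (huniq ⟨f, hf⟩ d hfd).trans hd⟩
  -- Homotopy and equality of classes both amount to the quotient of the two maps having an
  -- equivariant real lift.
  have hker : homotopyCon ι θ = Con.ker Ψ := by
    ext f g
    rw [Con.ker_rel]
    change ContinuousMap.HomotopicWith f.1 g.1 (IsEquivariant ι θ) ↔
      (C f : Cohomology (signedCochains (diagonal τ ι) ε) 1) = C g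
    rw [homotopicWith_isEquivariant_iff hθ f.2]
    constructor
    · rintro ⟨k, hk, hfg⟩
      refine (huniq g (C f) ?_).symm
      have hg : g.1 = f.1 * unitExp.comp k := by
        ext x
        rw [hfg x]
        rfl
      have := (hrep f).mul (represents_unitExp_comp (τ := τ) hk)
      rwa [add_zero, ← hg] at this
    · intro h
      obtain ⟨b, hb, hbc⟩ := signedCohomology_mk_eq_iff.1 h
      have hfg := (hrep f).inv.mul (hrep g)
      rw [show -c f + c g = coboundary (E × X) 0 b from hbc.symm] at hfg
      obtain ⟨k, hk, hkf⟩ := hfg.exists_lift hb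
      refine ⟨k, hk, fun x => ?_⟩
      rw [hkf, ContinuousMap.mul_apply, ContinuousMap.inv_apply, mul_inv_cancel_left]
  let e : HomotopyClasses ι θ ≃*
      Multiplicative (Cohomology (signedCochains (diagonal τ ι) ε) 1) :=
    (Con.congr (MulEquiv.refl _) (by rw [hker]; rfl)).trans (Con.quotientKerEquivOfSurjective Ψ hsurj)
  exact ⟨(MulEquiv.toAdditive e).symm⟩

end

/-! ### Cohomology of the quotient by a free involution -/

section Quotient

variable {Y : Type u} [TopologicalSpace Y] {σ : C(Y, Y)} (hσ : Function.Involutive σ)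

/-- The projection to the quotient by an involution. -/
def orbitProj : C(Y, Quotient (orbitSetoid σ hσ)) := ⟨Quotient.mk _, continuous_quotient_mk'⟩

theorem orbitProj_eq_iff {y z : Y} : orbitProj hσ y = orbitProj hσ z ↔ y = z ∨ σ y = z :=
  Quotient.eq

theorem orbitProj_comp : (orbitProj hσ).comp σ = orbitProj hσ := by
  ext y
  exact (orbitProj_eq_iff hσ).2 (Or.inr (hσ y))

theorem isCoveringMap_orbitProj
    (hdisj : ∀ y : Y, ∃ U : Set Y, IsOpen U ∧ y ∈ U ∧ Disjoint U (σ '' U)) :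
    IsCoveringMap (orbitProj hσ) := by
  classical
  -- The involution as an action of the group of signs, with `-1` acting as `σ`.
  let _ : MulAction ℤˣ Y :=
    { smul := fun g y => if g = 1 then y else σ y
      one_smul := fun y => if_pos rfl
      mul_smul := fun g h y => by
        change (if g * h = 1 then y else σ y) =
          if g = 1 then (if h = 1 then y else σ y) else σ (if h = 1 then y else σ y)
        rcases Int.units_eq_one_or g with rfl | rfl <;> rcases Int.units_eq_one_or h with rfl | rfl <;>
          simp [hσ y] }
  have hneg : ∀ y : Y, (-1 : ℤˣ) • y = σ y := fun y => if_neg (by decide)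
  have hcov : IsQuotientCoveringMap (orbitProj hσ) ℤˣ :=
    { isQuotientMap_quotient_mk' with
      continuous_const_smul := fun g => by
        rcases Int.units_eq_one_or g with rfl | rfl
        · simpa only [one_smul] using continuous_id'
        · simpa only [hneg] using map_continuous σ
      apply_eq_iff_mem_orbit := by
        intro y z
        rw [orbitProj_eq_iff, MulAction.mem_orbit_iff]
        constructor
        · rintro (rfl | rfl)
          · exact ⟨1, one_smul _ _⟩
          · exact ⟨-1, (hneg _).trans (hσ _)⟩
        · rintro ⟨g, rfl⟩
          rcases Int.units_eq_one_or g with rfl | rfl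
          · exact Or.inl (one_smul _ _)
          · exact Or.inr (by rw [hneg, hσ])
      disjoint := by
        intro y
        obtain ⟨U, hU, hy, hd⟩ := hdisj y
        refine ⟨U, hU.mem_nhds hy, fun g hg => ?_⟩
        rcases Int.units_eq_one_or g with rfl | rfl
        · rfl
        · obtain ⟨z, hz, hzU⟩ := hg
          simp only [hneg] at hz
          exact (disjoint_left.1 hd hzU hz).elim }
  exact hcov.isCoveringMap

variable {hσ}

/-- Extended to a vector space by the simplex retraction, the simplex satisfies the lifting
criterion for coverings. -/
theorem exists_lift_simplex (hcov : IsCoveringMap (orbitProj hσ)) {n : ℕ}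
    (s : SingularSimplex (Quotient (orbitSetoid σ hσ)) n) :
    ∃ t : SingularSimplex Y n, (orbitProj hσ).comp t = s := by
  obtain ⟨y, hy⟩ := Quotient.mk_surjective (s (simplexRetraction n 0))
  obtain ⟨t, ⟨-, ht⟩, -⟩ := hcov.existsUnique_continuousMap_lifts (s.comp (simplexRetraction n)) 0
    y hy
  refine ⟨t.comp (affineSimplex fun i => Pi.single i 1), ?_⟩
  conv_rhs => rw [exists_eq_comp_affineSimplex s]
  ext z
  exact congrFun ht _

/-- After applying `σ` if necessary, the two lifts agree at a vertex, and hence everywhere because a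
simplex is connected. -/
theorem eq_or_eq_of_orbitProj_comp_eq (hcov : IsCoveringMap (orbitProj hσ)) {n : ℕ}
    {s t : SingularSimplex Y n} (h : (orbitProj hσ).comp s = (orbitProj hσ).comp t) :
    s = t ∨ σ.comp s = t := by
  let v : stdSimplex ℝ (Fin (n + 1)) := stdSimplex.vertex 0
  have hv : orbitProj hσ (s v) = orbitProj hσ (t v) := congrArg (fun f => f v) h
  rcases (orbitProj_eq_iff hσ).1 hv with hv | hv
  · exact Or.inl (DFunLike.coe_injective
      (hcov.eq_of_comp_eq s.continuous t.continuous (congrArg DFunLike.coe h) v hv))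
  · refine Or.inr (DFunLike.coe_injective
      (hcov.eq_of_comp_eq (σ.comp s).continuous t.continuous ?_ v hv))
    rw [← ContinuousMap.coe_comp, ← ContinuousMap.comp_assoc, orbitProj_comp, h]
    rfl

theorem pullback_orbitProj_mem {n : ℕ} (c : Cochain (Quotient (orbitSetoid σ hσ)) n) :
    c.pullback (orbitProj hσ) ∈ signedCochains σ 1 n := by
  intro s
  rw [one_mul]
  change c ((orbitProj hσ).comp (σ.comp s)) = c ((orbitProj hσ).comp s)
  rw [← ContinuousMap.comp_assoc, orbitProj_comp]

theorem pullback_orbitProj_injective (hcov : IsCoveringMap (orbitProj hσ)) {n : ℕ} :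
    Function.Injective fun c : Cochain (Quotient (orbitSetoid σ hσ)) n =>
      c.pullback (orbitProj hσ) := by
  intro c d h
  funext s
  obtain ⟨t, rfl⟩ := exists_lift_simplex hcov s
  exact congrFun h t

theorem exists_pullback_orbitProj_eq (hcov : IsCoveringMap (orbitProj hσ)) {n : ℕ} {c : Cochain Y n}
    (hc : c ∈ signedCochains σ 1 n) :
    ∃ d : Cochain (Quotient (orbitSetoid σ hσ)) n, d.pullback (orbitProj hσ) = c := by
  choose t ht using fun s : SingularSimplex (Quotient (orbitSetoid σ hσ)) n =>
    exists_lift_simplex hcov s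
  refine ⟨fun s => c (t s), ?_⟩
  funext s
  rcases eq_or_eq_of_orbitProj_comp_eq hcov (ht ((orbitProj hσ).comp s)).symm with h | h
  · exact congrArg c h.symm
  · change c (t _) = c s
    rw [← h, hc, one_mul]

/-- Pull-back identifies the cochains of the quotient with the invariant cochains upstairs,
compatibly with coboundaries. -/
theorem nonempty_singularCohomology_quotient_addEquiv (hcov : IsCoveringMap (orbitProj hσ)) :
    Nonempty (SingularCohomology (Quotient (orbitSetoid σ hσ)) 1 ≃+
      Cohomology (signedCochains σ 1) 1) := by
  let T : cocycles (Y := Quotient (orbitSetoid σ hσ)) (fun _ => ⊤) 1 →+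
      cocycles (signedCochains σ 1) 1 :=
    { toFun := fun c => ⟨c.1.pullback (orbitProj hσ), mem_cocycles_signedCochains.2
        ⟨pullback_orbitProj_mem _, IsCocycle.pullback c.2.2 _⟩⟩
      map_zero' := rfl
      map_add' := fun _ _ => rfl }
  have hT : Function.Bijective T := by
    refine ⟨fun c d h => Subtype.ext (pullback_orbitProj_injective hcov (congrArg Subtype.val h)),
      fun c => ?_⟩
    obtain ⟨hc, hcc⟩ := mem_cocycles_signedCochains.1 c.2
    obtain ⟨d, hd⟩ := exists_pullback_orbitProj_eq hcov hc
    refine ⟨⟨d, trivial, pullback_orbitProj_injective hcov ?_⟩, Subtype.ext hd⟩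
    change (coboundary _ 1 d).pullback (orbitProj hσ) = 0
    rw [← coboundary_pullback, hd]
    exact hcc
  refine ⟨QuotientAddGroup.congr _ _ (AddEquiv.ofBijective T hT) ?_⟩
  ext c
  constructor
  · rintro ⟨d, ⟨b, -, hb⟩, rfl⟩
    refine ⟨b.pullback (orbitProj hσ), pullback_orbitProj_mem b, ?_⟩
    rw [coboundary_pullback, hb]
    rfl
  · rintro ⟨b, hb, hbc⟩
    obtain ⟨b, rfl⟩ := exists_pullback_orbitProj_eq hcov hb
    obtain ⟨d, rfl⟩ := hT.2 c
    refine ⟨d, ⟨b, trivial, pullback_orbitProj_injective hcov ?_⟩, rfl⟩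
    exact hbc

end Quotient

/-! ### The two signs and the conclusion -/

theorem id_unitExp (x : ℝ) : MonoidHom.id Circle (unitExp x) = unitExp ((1 : ℤ) * x) := by
  simp

theorem circleConj_unitExp (x : ℝ) : circleConj (unitExp x) = unitExp ((-1 : ℤ) * x) := by
  rw [Int.cast_neg, Int.cast_one, neg_one_mul, unitExp_neg]
  exact Circle.ext (Circle.coe_inv_eq_conj _).symm

end EquivCoh

end

theorem mainTheorem11 {X : Type*} [TopologicalSpace X] [T2Space X]
    (ι : C(X, X)) (hι : Function.Involutive ι)
    [Topology.CWComplex (Set.univ : Set X)] (hX : EquivCoh.IsZ2CW ι)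
    {E : Type*} [TopologicalSpace E] (τ : C(E, E)) (hτ : EquivCoh.IsUniversalFree τ) :
    Nonempty (EquivCoh.BorelCohomology τ ι hτ.involutive hι 1 ≃+
        Additive (EquivCoh.HomotopyClasses ι (MonoidHom.id Circle))) ∧
      Nonempty (EquivCoh.TwistedBorelCohomology τ ι 1 ≃+
        Additive (EquivCoh.HomotopyClasses ι EquivCoh.circleConj)) := by
  constructor
  · obtain ⟨e⟩ := EquivCoh.nonempty_signedCohomology_addEquiv (ε := 1) hτ hι (by norm_num)
      EquivCoh.id_unitExp
    obtain ⟨e'⟩ := EquivCoh.nonempty_singularCohomology_quotient_addEquiv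
      (EquivCoh.isCoveringMap_orbitProj (σ := EquivCoh.diagonal τ ι)
        (EquivCoh.diagonal_involutive hτ.involutive hι) (by
          rintro ⟨e, x⟩
          obtain ⟨U, hU, he, hd⟩ := hτ.exists_disjoint e
          refine ⟨Prod.fst ⁻¹' U, hU.preimage continuous_fst, he, Set.disjoint_left.2 ?_⟩
          rintro _ hz ⟨⟨e', x'⟩, he', rfl⟩
          exact Set.disjoint_left.1 hd hz ⟨e', he', rfl⟩))
    exact ⟨e'.trans e⟩
  · have h := EquivCoh.nonempty_signedCohomology_addEquiv (ε := -1) hτ hι (by norm_num)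
      EquivCoh.circleConj_unitExp
    rwa [← EquivCoh.antiInvariantCochains_eq] at h
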